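/- For a positive integer $n$ let $\mathbb{M}_n$ be the set of matroids with ground set $[n]=\{1,\dots,n\}$, and for a matroid $N$ let $\mathrm{Ex}(N)$ be the class of matroids that have no minor isomorphic to $N$. Let $U_{r,m}$ be the uniform matroid of rank $r$ on $m$ elements, and let $P_6$, $Q_6$, $R_6$ be the rank-$3$ matroids on six elements whose non-bases (dependent $3$-element sets) are, respectively: a single $3$-set; two $3$-sets with exactly one common element; two disjoint $3$-sets. **Theorem.** If $N=U_{2,k}$ for some $k\ge 2$, or if $N$ is one of $U_{3,6}$, $P_6$, $Q_6$ or $R_6$, then $$\log|\mathrm{Ex}(N)\cap\mathbb{M}_n| = O\!\left(\frac{2^n}{n^{5/2}}\log^2(n)\right)\qquad\text{as } n\to\infty,$$ where logarithms are to the base $2$ and the implied constant may depend on $N$. -/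

import Mathlib

open scoped Asymptotics

namespace MatroidCount

/-- `M` and `N` are isomorphic: some bijection between their ground sets preserves independence
in both directions. -/
def Isom {α β : Type*} (M : Matroid α) (N : Matroid β) : Prop :=
  ∃ e : M.E ≃ N.E, ∀ I : Set M.E,
    M.Indep ((fun x : M.E => (x : α)) '' I) ↔ N.Indep ((fun x : M.E => (e x : β)) '' I)

/-- `M` has an `N`-minor: some minor of `M` is isomorphic to `N`. -/
def HasMinor {α β : Type*} (M : Matroid α) (N : Matroid β) : Prop :=
  ∃ M' : Matroid α, M'.IsMinor M ∧ Isom M' N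

/-- The set of (labelled) matroids with ground set `[n] = {1, …, n}`. -/
def matroidsOn (n : ℕ) : Set (Matroid ℕ) := {M | M.E = Set.Icc 1 n}

/-- The set of matroids with ground set `[n]` that have no `N`-minor. -/
def exOn {β : Type*} (N : Matroid β) (n : ℕ) : Set (Matroid ℕ) :=
  {M | M ∈ matroidsOn n ∧ ¬ HasMinor M N}

/-- There are finitely many matroids on `[n]`, so that `Set.ncard` really counts them. -/
theorem matroidsOn_finite (n : ℕ) : (matroidsOn n).Finite := by
  apply Set.Finite.of_finite_image (f := fun M : Matroid ℕ => {I | M.Indep I})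
  · apply ((Set.finite_Icc 1 n).finite_subsets.finite_subsets).subset
    rintro _ ⟨M, hM, rfl⟩ I hI
    have h : M.E = Set.Icc 1 n := hM
    exact h ▸ Matroid.Indep.subset_ground hI
  · intro M hM M' hM' h
    have h1 : M.E = Set.Icc 1 n := hM
    have h2 : M'.E = Set.Icc 1 n := hM'
    refine Matroid.ext_indep (h1.trans h2.symm) fun I _ => ?_
    exact Set.ext_iff.1 h I

theorem exOn_finite {β : Type*} (N : Matroid β) (n : ℕ) : (exOn N n).Finite :=
  (matroidsOn_finite n).subset fun _ h => h.1

/-- The uniform matroid `U_{r,m}`: the ground set has `m` elements, and a set is independent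
iff it has at most `r` elements. -/
def unif (r m : ℕ) : Matroid (Fin m) :=
  (IndepMatroid.ofFinset Set.univ (fun I : Finset (Fin m) => I.card ≤ r)
    (Finset.card_empty.le.trans (Nat.zero_le r))
    (fun _ _ hJ hIJ => (Finset.card_le_card hIJ).trans hJ)
    (fun I J _ hJ hIJ => by
      obtain ⟨e, heJ, heI⟩ := Finset.exists_mem_notMem_of_card_lt_card hIJ
      refine ⟨e, heJ, heI, ?_⟩
      rw [Finset.card_insert_of_notMem heI]
      omega)
    (by simp)).matroid

theorem unif_indep_iff (r m : ℕ) (I : Finset (Fin m)) :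
    (unif r m).Indep (I : Set (Fin m)) ↔ I.card ≤ r := by
  simp [unif]

/-- The rank-`r` matroid on `m` elements whose non-bases are exactly the members of `C`, where `C`
is a family of `r`-sets any two of which have at most `r - 2` elements in common: a set is
independent iff it has at most `r` elements and is not in `C`. -/
def ofNonbases (r m : ℕ) (C : Finset (Finset (Fin m))) (hr : 0 < r)
    (hC : ∀ X ∈ C, X.card = r)
    (hCC : ∀ X ∈ C, ∀ Y ∈ C, X ≠ Y → (X ∩ Y).card + 2 ≤ r) : Matroid (Fin m) :=
  (IndepMatroid.ofFinset Set.univ (fun I : Finset (Fin m) => I.card ≤ r ∧ I ∉ C)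
    ⟨by simp, fun h => by have := hC _ h; simp at this; omega⟩
    (fun I J hJ hIJ => by
      refine ⟨(Finset.card_le_card hIJ).trans hJ.1, fun hI => ?_⟩
      have h1 := hC _ hI
      have h2 : I = J := Finset.eq_of_subset_of_card_le hIJ (by omega)
      exact hJ.2 (h2 ▸ hI))
    (fun I J hI hJ hIJ => by
      obtain ⟨e, heJ, heI⟩ := Finset.exists_mem_notMem_of_card_lt_card hIJ
      have hJr := hJ.1
      by_cases he : insert e I ∈ C
      · have hcard := hC _ he
        rw [Finset.card_insert_of_notMem heI] at hcard
        have hne : ¬ J ⊆ insert e I := fun hs => by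
          have h2 : J = insert e I := Finset.eq_of_subset_of_card_le hs (by
            rw [Finset.card_insert_of_notMem heI]; omega)
          exact hJ.2 (h2 ▸ he)
        obtain ⟨f, hfJ, hf⟩ := Finset.not_subset.1 hne
        rw [Finset.mem_insert, not_or] at hf
        refine ⟨f, hfJ, hf.2, ?_, fun hfC => ?_⟩
        · rw [Finset.card_insert_of_notMem hf.2]; omega
        · have h3 := hCC _ he _ hfC (fun h => by
            have h4 : f ∈ insert e I := h ▸ Finset.mem_insert_self f I
            simp [hf.1, hf.2] at h4)
          have h5 : I.card ≤ (insert e I ∩ insert f I).card :=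
            Finset.card_le_card
              (Finset.subset_inter (Finset.subset_insert _ _) (Finset.subset_insert _ _))
          omega
      · refine ⟨e, heJ, heI, ?_, he⟩
        rw [Finset.card_insert_of_notMem heI]; omega)
    (by simp)).matroid

theorem ofNonbases_indep_iff (r m : ℕ) (C : Finset (Finset (Fin m))) (hr : 0 < r)
    (hC : ∀ X ∈ C, X.card = r)
    (hCC : ∀ X ∈ C, ∀ Y ∈ C, X ≠ Y → (X ∩ Y).card + 2 ≤ r) (I : Finset (Fin m)) :
    (ofNonbases r m C hr hC hCC).Indep (I : Set (Fin m)) ↔ I.card ≤ r ∧ I ∉ C := by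
  simp [ofNonbases]

/-- `P₆`: rank 3, six elements, a single three-point line as only non-basis. -/
def P6 : Matroid (Fin 6) :=
  ofNonbases 3 6 {{0, 1, 2}} (by decide) (by decide) (by decide)

set_option maxRecDepth 4000 in
/-- `Q₆`: rank 3, six elements, the non-bases are two three-point lines with a common point. -/
def Q6 : Matroid (Fin 6) :=
  ofNonbases 3 6 {{0, 1, 2}, {0, 3, 4}} (by decide) (by decide) (by decide)

set_option maxRecDepth 4000 in
/-- `R₆`: rank 3, six elements, the non-bases are two disjoint three-point lines. -/
def R6 : Matroid (Fin 6) :=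
  ofNonbases 3 6 {{0, 1, 2}, {3, 4, 5}} (by decide) (by decide) (by decide)

/-- `log |Ex(N) ∩ 𝕄_n| = O(2^n log²(n) / n^{5/2})` as `n → ∞`, with logarithms to the base 2;
the implied constant may depend on `N`. -/
def SmallExcluded {β : Type*} (N : Matroid β) : Prop :=
  (fun n : ℕ => Real.logb 2 ((exOn N n).ncard : ℝ)) =O[Filter.atTop]
    (fun n : ℕ => (2 : ℝ) ^ n / (n : ℝ) ^ (5 / 2 : ℝ) * (Real.logb 2 (n : ℝ)) ^ 2)

end MatroidCount

namespace MatroidCount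

open Finset

/-! Every matroid in the class is described by about `2 ^ n * log n / n ^ (5/2)` subsets of `[n]`,
besides data of negligible size; naming these subsets costs another factor `log n`.

The description is a code `(B, S, H)`. A code determines the matroid (`IsCode.eq`) because any base
is reached from `B` by exchanges, so only non-bases of nullity one have to be certified. Such an `X`
contains a unique circuit. If that circuit has at most `n / 4` elements, it belongs to `S`, the
family of all small dependent sets, which costs at most `(9/5) ^ n` bits. Otherwise `X` contains at
least `n ^ s / (8 ^ s * s!)` sets `T = X \ Y`, where `Y` consists of `s` elements of the circuit.
Among the at most `2 ^ n / √n` sets of size `r - s`, where `r` is the rank, a greedy choice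
(`exists_hitting`) of order `2 ^ n * log n / n ^ (s + 1/2)` sets `T` serves all but `2 ^ n / n ^
(5/2)` of the `X` (`exists_isCode`).

In the rank-`s` contraction by such a `T`, the set `Y` is a circuit spanning a hyperplane.
`FlatSparse` says that excluding `N` leaves only `O(n ^ (s - 2))` hyperplanes to record, so `n ^ s`
cancels up to `n ^ 2`. It remains to prove this sparsity. For `U_{2,k}` take `s = 2`: the
contraction has boundedly many points. For the rank-3 matroids take `s = 3`: the simplified
contraction is a linear space, and a linear space without the forbidden six-point configuration has
linearly many lines with at least three points. -/

/-! ### Binomial coefficients. -/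

/-- The factor `2 * m + 1` makes the induction close, through `(2m + 1)(2m + 3) ≤ (2m + 2)²`. -/
theorem centralBinom_sq_mul_le (m : ℕ) : m.centralBinom ^ 2 * (2 * m + 1) ≤ 4 ^ (2 * m) := by
  induction m with
  | zero => simp
  | succ m ih =>
    have h := Nat.succ_mul_centralBinom_succ m
    have h1 : (m + 1) ^ 2 * ((m + 1).centralBinom ^ 2 * (2 * (m + 1) + 1)) ≤
        (m + 1) ^ 2 * 4 ^ (2 * (m + 1)) := by
      calc (m + 1) ^ 2 * ((m + 1).centralBinom ^ 2 * (2 * (m + 1) + 1))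
          = ((m + 1) * (m + 1).centralBinom) ^ 2 * (2 * m + 3) := by ring
        _ = 4 * ((2 * m + 1) * (2 * m + 3)) * (m.centralBinom ^ 2 * (2 * m + 1)) := by
            rw [h]; ring
        _ ≤ 4 * (4 * (m + 1) ^ 2) * 4 ^ (2 * m) :=
            Nat.mul_le_mul (Nat.mul_le_mul_left _ (by nlinarith)) ih
        _ = (m + 1) ^ 2 * 4 ^ (2 * (m + 1)) := by ring
    exact Nat.le_of_mul_le_mul_left h1 (by positivity)

theorem choose_sq_mul_le (n r : ℕ) : n.choose r ^ 2 * n ≤ 4 ^ n := by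
  rcases Nat.even_or_odd' n with ⟨m, rfl | rfl⟩
  · calc (2 * m).choose r ^ 2 * (2 * m) ≤ m.centralBinom ^ 2 * (2 * m + 1) :=
          Nat.mul_le_mul (Nat.pow_le_pow_left (Nat.choose_le_centralBinom r m) 2) (by omega)
      _ ≤ _ := centralBinom_sq_mul_le m
  · have h : (2 * m + 1).choose r ≤ 2 * m.centralBinom := by
      cases r with
      | zero => have := Nat.centralBinom_pos m; simp; omega
      | succ r =>
        rw [Nat.choose_succ_succ]
        have := Nat.choose_le_centralBinom r m
        have := Nat.choose_le_centralBinom (r + 1) m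
        simp only [Nat.succ_eq_add_one]; omega
    calc (2 * m + 1).choose r ^ 2 * (2 * m + 1) ≤ (2 * m.centralBinom) ^ 2 * (2 * m + 1) :=
          Nat.mul_le_mul_right _ (Nat.pow_le_pow_left h 2)
      _ = 4 * (m.centralBinom ^ 2 * (2 * m + 1)) := by ring
      _ ≤ 4 * 4 ^ (2 * m) := Nat.mul_le_mul_left _ (centralBinom_sq_mul_le m)
      _ = 4 ^ (2 * m + 1) := by ring

theorem choose_mul_sqrt_le (n r : ℕ) : (n.choose r : ℝ) * √n ≤ 2 ^ n := by
  have h : ((n.choose r : ℝ) * √n) ^ 2 ≤ (2 ^ n) ^ 2 := by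
    rw [mul_pow, Real.sq_sqrt (Nat.cast_nonneg n), ← pow_mul, mul_comm n 2, pow_mul]
    norm_num
    exact_mod_cast choose_sq_mul_le n r
  exact le_of_sq_le_sq h (by positivity)

/-! ### Greedy hitting sets and the number of small subfamilies. -/

/-- Greedy choice: if every `i ∈ X` is related to at least `d` elements of `A`, then `k` elements of
`A` can be chosen so that few elements of `X` are unrelated to all of them. -/
theorem exists_hitting {ι α : Type*} [DecidableEq ι] [DecidableEq α] (X : Finset ι) (A : Finset α)
    (R : ι → α → Prop) [∀ i, DecidablePred (R i)] (d : ℝ) (hd : ∀ i ∈ X, d ≤ #{t ∈ A | R i t})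
    (k : ℕ) : ∃ T ⊆ A, #T ≤ k ∧
      (#{i ∈ X | ∀ t ∈ T, ¬ R i t} : ℝ) ≤ #X * Real.exp (-(d / #A) * k) := by
  induction k with
  | zero => exact ⟨∅, by simp⟩
  | succ k ih =>
    obtain ⟨T, hTA, hTk, hT⟩ := ih
    rcases A.eq_empty_or_nonempty with rfl | hA
    · exact ⟨∅, by simp⟩
    set U : Finset ι := {i ∈ X | ∀ t ∈ T, ¬ R i t} with hU
    have hA0 : (0 : ℝ) < #A := by exact_mod_cast hA.card_pos
    -- Counting related pairs in two ways: some `t` hits at least the average share `d / #A` of the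
    -- elements `U` not yet hit.
    have hsum : ∑ t ∈ A, (#U : ℝ) * d / #A ≤ ∑ t ∈ A, (#{i ∈ U | R i t} : ℝ) := by
      rw [sum_const, nsmul_eq_mul, mul_div_cancel₀ _ hA0.ne']
      have h1 : ∑ t ∈ A, #{i ∈ U | R i t} = ∑ i ∈ U, #{t ∈ A | R i t} := by
        simp only [card_filter]
        exact sum_comm
      rw [← Nat.cast_sum, h1, Nat.cast_sum, ← nsmul_eq_mul, ← sum_const]
      exact sum_le_sum fun i hi => hd i (mem_filter.1 hi).1
    obtain ⟨t, htA, ht⟩ := exists_le_of_sum_le hA hsum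
    refine ⟨insert t T, insert_subset htA hTA, (card_insert_le _ _).trans (by omega), ?_⟩
    have hsplit : #{i ∈ U | R i t} + #{i ∈ U | ¬ R i t} = #U :=
      card_filter_add_card_filter_not _
    have heq : ({i ∈ X | ∀ u ∈ insert t T, ¬ R i u} : Finset ι) = {i ∈ U | ¬ R i t} := by
      ext i; simp only [hU, mem_filter, mem_insert, forall_eq_or_imp]; tauto
    rw [heq]
    have h2 : (#{i ∈ U | ¬ R i t} : ℝ) ≤ #U * Real.exp (-(d / #A)) := by
      have h3 : (#{i ∈ U | R i t} : ℝ) + #{i ∈ U | ¬ R i t} = #U := by exact_mod_cast hsplit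
      have h4 : (#U : ℝ) * (-(d / #A) + 1) ≤ #U * Real.exp (-(d / #A)) :=
        mul_le_mul_of_nonneg_left (Real.add_one_le_exp _) (Nat.cast_nonneg _)
      have h5 : (#U : ℝ) * d / #A = #U * (d / #A) := mul_div_assoc _ _ _
      linarith
    refine h2.trans ((mul_le_mul_of_nonneg_right hT (Real.exp_pos _).le).trans_eq ?_)
    rw [mul_assoc, ← Real.exp_add]
    push_cast
    ring_nf

/-- Each counted subset contributes at least `x ^ m` to the binomial expansion of `(1 + x) ^ #P`. -/
theorem card_powerset_filter_mul_pow_le {α : Type*} (P : Finset α) (m : ℕ) {x : ℝ} (hx : 0 < x)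
    (hx1 : x ≤ 1) : (#{H ∈ P.powerset | #H ≤ m} : ℝ) * x ^ m ≤ (1 + x) ^ #P := by
  have h := sum_pow_mul_eq_add_pow x 1 P
  simp only [one_pow, mul_one] at h
  rw [add_comm 1 x, ← h, ← nsmul_eq_mul, ← sum_const]
  calc ∑ _H ∈ P.powerset with #_H ≤ m, x ^ m ≤ ∑ H ∈ P.powerset with #H ≤ m, x ^ #H :=
        sum_le_sum fun H hH => pow_le_pow_of_le_one hx.le hx1 (mem_filter.1 hH).2
    _ ≤ _ := sum_le_sum_of_subset_of_nonneg (filter_subset _ _) fun _ _ _ => by positivity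

/-- Few subsets of an `n`-set have at most `n / 4` elements. -/
theorem card_small_subsets_le {α : Type*} (P : Finset α) :
    (#{S ∈ P.powerset | 4 * #S ≤ #P} : ℝ) ≤ (9 / 5) ^ #P := by
  have h := card_powerset_filter_mul_pow_le P (#P / 4) (x := 1 / 2) (by norm_num) (by norm_num)
  have h1 : ({S ∈ P.powerset | 4 * #S ≤ #P} : Finset (Finset α)) =
      {S ∈ P.powerset | #S ≤ #P / 4} := by
    ext S; simp only [mem_filter]; rw [Nat.le_div_iff_mul_le (by norm_num), mul_comm]
  rw [h1]
  set a : ℝ := (#{S ∈ P.powerset | #S ≤ #P / 4} : ℝ)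
  have ha : 0 ≤ a := Nat.cast_nonneg _
  -- Here `(5/6) ^ 4 ≤ 1/2`, and `9/5 = (3/2) / (5/6)`. All that matters later is that the base is
  -- below 2.
  have h2 : (5 / 6 : ℝ) ^ #P ≤ (1 / 2) ^ (#P / 4) := by
    calc (5 / 6 : ℝ) ^ #P ≤ (5 / 6) ^ (4 * (#P / 4)) :=
          pow_le_pow_of_le_one (by norm_num) (by norm_num) (Nat.mul_div_le _ _)
      _ = ((5 / 6) ^ 4) ^ (#P / 4) := pow_mul _ _ _
      _ ≤ _ := pow_le_pow_left₀ (by norm_num) (by norm_num) _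
  have h3 : a * (5 / 6) ^ #P ≤ (3 / 2) ^ #P :=
    (mul_le_mul_of_nonneg_left h2 ha).trans (h.trans_eq (by norm_num))
  have h4 : (9 / 5 : ℝ) ^ #P * (5 / 6) ^ #P = (3 / 2) ^ #P := by rw [← mul_pow]; norm_num
  exact le_of_mul_le_mul_right (h3.trans_eq h4.symm) (by positivity)

/-! ### Codes determine matroids. -/

/-- `(B, S, H)` encodes `M`: `B` is a base, the members of `S` are dependent, those of `H` are not
spanning, and each non-base of full size and nullity one contains a member of `S` or lies in a
member of `H`. -/
structure IsCode (M : Matroid ℕ) (B : Finset ℕ) (S H : Finset (Finset ℕ)) : Prop where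
  isBase : M.IsBase B
  not_indep : ∀ C ∈ S, ¬ M.Indep C
  not_isBase : ∀ K ∈ H, ∀ I ⊆ K, ¬ M.IsBase I
  cover : ∀ X : Finset ℕ, (X : Set ℕ) ⊆ M.E → #X = #B → ¬ M.Indep X →
    (∃ e ∈ X, M.Indep (X.erase e)) → (∃ C ∈ S, C ⊆ X) ∨ ∃ K ∈ H, X ⊆ K

theorem card_eq_of_isBase {M : Matroid ℕ} {B B' : Finset ℕ} (hB : M.IsBase B) (hB' : M.IsBase B') :
    #B = #B' := by
  simpa using hB.ncard_eq_ncard_of_isBase hB'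

theorem isBase_of_indep_of_card_eq {M : Matroid ℕ} {B I : Finset ℕ} (hB : M.IsBase B)
    (hI : M.Indep I) (h : #I = #B) : M.IsBase I := by
  obtain ⟨B', hB', hIB'⟩ := hI.exists_isBase_superset
  have hfin : B'.Finite := hB.finite_of_finite B.finite_toSet hB'
  lift B' to Finset ℕ using hfin
  rw [coe_subset] at hIB'
  have := card_eq_of_isBase hB hB'
  rwa [eq_of_subset_of_card_le hIB' (by omega)]

/-- Induction on the distance to the common base `B`. An exchange in `M` brings `X` closer to `B`,
so the new base is also one of `M'`. A certificate that `X` is not a base of `M'` would certify the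
same for `M`. -/
theorem IsCode.isBase_of_isBase {M M' : Matroid ℕ} {B : Finset ℕ} {S H : Finset (Finset ℕ)}
    (h : IsCode M B S H) (h' : IsCode M' B S H) (hE : M.E = M'.E) (k : ℕ) :
    ∀ X : Finset ℕ, #(X \ B) = k → M.IsBase X → M'.IsBase X := by
  induction k with
  | zero =>
    intro X hX hXM
    have h1 : X ⊆ B := by rwa [card_eq_zero, sdiff_eq_empty_iff_subset] at hX
    rw [eq_of_subset_of_card_le h1 (card_eq_of_isBase hXM h.isBase).ge]
    exact h'.isBase
  | succ k ih =>
    intro X hX hXM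
    obtain ⟨e, he⟩ : (X \ B).Nonempty := card_pos.1 (by omega)
    have he' := mem_sdiff.1 he
    obtain ⟨f, hf, hXf⟩ := hXM.exchange h.isBase (e := e) (by simpa using he')
    have hf' : f ∈ B ∧ f ∉ X := by simpa using hf
    have hcoe : insert f ((X : Set ℕ) \ {e}) = ((insert f (X.erase e) : Finset ℕ) : Set ℕ) := by
      simp
    rw [hcoe] at hXf
    have hcard : #(insert f (X.erase e) \ B) = k := by
      have : insert f (X.erase e) \ B = (X \ B).erase e := by
        ext x; simp only [mem_sdiff, mem_insert, mem_erase]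
        constructor
        · rintro ⟨rfl | h, h2⟩
          · exact absurd hf'.1 h2
          · exact ⟨h.1, h.2, h2⟩
        · rintro ⟨h1, h2, h3⟩
          exact ⟨Or.inr ⟨h1, h2⟩, h3⟩
      rw [this, card_erase_of_mem he]; omega
    have hM' := ih _ hcard hXf
    -- This gives `X` nullity at most one in `M'`, the only case in which `cover` promises a
    -- certificate.
    have hXe : M'.Indep (X.erase e) :=
      hM'.indep.subset (by exact_mod_cast subset_insert f (X.erase e))
    have hXc := card_eq_of_isBase hXM h.isBase
    refine isBase_of_indep_of_card_eq h'.isBase (by_contra fun hdep => ?_) hXc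
    rcases h'.cover X (hE ▸ hXM.subset_ground) hXc hdep ⟨e, he'.1, hXe⟩ with
      ⟨C, hC, hCX⟩ | ⟨K, hK, hXK⟩
    · exact h.not_indep C hC (hXM.indep.subset (by exact_mod_cast hCX))
    · exact h.not_isBase K hK X hXK hXM

theorem IsCode.eq {M M' : Matroid ℕ} {B : Finset ℕ} {S H : Finset (Finset ℕ)}
    (h : IsCode M B S H) (h' : IsCode M' B S H) (hE : M.E = M'.E) : M = M' := by
  have key : ∀ {M M' : Matroid ℕ}, IsCode M B S H → IsCode M' B S H → M.E = M'.E →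
      ∀ X, M.IsBase X → M'.IsBase X := by
    intro M M' h h' hE X hX
    have hfin : X.Finite := h.isBase.finite_of_finite B.finite_toSet hX
    lift X to Finset ℕ using hfin
    exact h.isBase_of_isBase h' hE _ X rfl hX
  exact Matroid.ext_isBase hE fun X _ => ⟨key h h' hE X, key h' h hE.symm X⟩

/-! ### Existence of short codes. -/

/-- Contracting an independent set to rank `s` in a matroid on `[n]` without `N`-minor leaves at
most `c n ^ (s - 2)` hyperplanes that contain all the circuits of size `s`. -/
def FlatSparse {β : Type*} (N : Matroid β) (s c : ℕ) : Prop :=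
  ∀ n : ℕ, 1 ≤ n → ∀ M ∈ exOn N n, ∀ T : Finset ℕ, M.Indep T →
    (∀ B : Finset ℕ, M.IsBase B → #B = #T + s) →
    ∃ H ⊆ (Icc 1 n).powerset, #H ≤ c * n ^ (s - 2) ∧ (∀ K ∈ H, ∀ I ⊆ K, ¬ M.IsBase I) ∧
      ∀ Y : Finset ℕ, (Y : Set ℕ) ⊆ M.E → #Y = s → Disjoint T Y →
        (∀ y ∈ Y, M.Indep (T ∪ Y.erase y : Finset ℕ)) →
        ¬ M.Indep (T ∪ Y : Finset ℕ) → ∃ K ∈ H, T ∪ Y ⊆ K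

open Classical in
/-- The elements whose deletion from a nullity-one set `X` leaves an independent set form a
dependent set. -/
theorem not_indep_filter_erase {M : Matroid ℕ} {X : Finset ℕ} (hXE : (X : Set ℕ) ⊆ M.E)
    (hX : ¬ M.Indep X) {e : ℕ} (he : e ∈ X) (hXe : M.Indep (X.erase e)) :
    ¬ M.Indep ({x ∈ X | M.Indep (X.erase x)} : Finset ℕ) := by
  have hins : insert e ((X.erase e : Finset ℕ) : Set ℕ) = X := by
    rw [← coe_insert, insert_erase he]
  have hen : e ∉ ((X.erase e : Finset ℕ) : Set ℕ) := by simp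
  have hecl : e ∈ M.closure (X.erase e : Finset ℕ) := by
    rw [hXe.mem_closure_iff_of_notMem hen, hins]
    exact ⟨hX, hXE⟩
  have hC := hXe.fundCircuit_isCircuit hecl hen
  -- The set in question is the fundamental circuit of `e`.
  have heq : M.fundCircuit e (X.erase e : Finset ℕ) =
      (({x ∈ X | M.Indep (X.erase x)} : Finset ℕ) : Set ℕ) := by
    ext x
    constructor
    · intro hx
      have hxX : x ∈ X := by
        have := M.fundCircuit_subset_insert e _ hx
        rw [hins] at this
        exact_mod_cast this
      rw [hXe.mem_fundCircuit_iff hecl hen, hins] at hx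
      simp only [coe_filter, Set.mem_ofPred_eq]
      exact ⟨hxX, by simpa using hx⟩
    · intro hx
      simp only [coe_filter, Set.mem_ofPred_eq] at hx
      rw [hXe.mem_fundCircuit_iff hecl hen, hins]
      simpa using hx.2
  rw [← heq]
  exact hC.not_indep

/-- As `m > n / 4` and `s ≤ n / 8`, even the smallest factor `m + 1 - s` of the falling factorial is
at least `n / 8`. -/
theorem pow_div_factorial_le_choose {n m s : ℕ} (hn : 8 * s ≤ n) (hm : n < 4 * m) :
    (n / 8 : ℝ) ^ s / s.factorial ≤ m.choose s := by
  have h := Nat.pow_le_choose s m (α := ℝ)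
  refine le_trans ?_ h
  gcongr
  have h1 : n ≤ 8 * (m + 1 - s) := by omega
  have h2 : (n : ℝ) ≤ 8 * ((m + 1 - s : ℕ) : ℝ) := by exact_mod_cast h1
  linarith

open Classical in
-- The first summand counts the hyperplanes supplied by `FlatSparse` for the `k` chosen sets `T`;
-- the second bounds the non-bases missed by all of them.
theorem exists_isCode {β : Type*} {N : Matroid β} {s c : ℕ} (hs : 1 ≤ s) (hN : FlatSparse N s c)
    {n : ℕ} (hn : 8 * s ≤ n) {M : Matroid ℕ} (hM : M ∈ exOn N n) (k : ℕ) :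
    ∃ B ∈ (Icc 1 n).powerset, ∃ S ⊆ {S ∈ (Icc 1 n).powerset | 4 * #S ≤ n},
      ∃ H ⊆ (Icc 1 n).powerset, IsCode M B S H ∧
      (#H : ℝ) ≤ k * (c * n ^ (s - 2) : ℕ) + 2 ^ n / √n *
        Real.exp (-((n / 8 : ℝ) ^ s / s.factorial * √n / 2 ^ n) * k) := by
  set d : ℝ := (n / 8 : ℝ) ^ s / s.factorial with hd
  have hE : M.E = ((Icc 1 n : Finset ℕ) : Set ℕ) := by rw [coe_Icc]; exact hM.1
  have hn0 : (0 : ℝ) < √n := Real.sqrt_pos.2 (by exact_mod_cast (by omega : 0 < n))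
  obtain ⟨B, hB⟩ := M.exists_isBase
  have hfin : B.Finite := (Icc 1 n).finite_toSet.subset (hE ▸ hB.subset_ground)
  lift B to Finset ℕ using hfin
  have hBE : B ⊆ Icc 1 n := by
    rw [← coe_subset, ← hE]; exact hB.subset_ground
  set r := #B with hr
  set S : Finset (Finset ℕ) := {S ∈ (Icc 1 n).powerset | 4 * #S ≤ n ∧ ¬ M.Indep S} with hS
  have hSsub : S ⊆ {S ∈ (Icc 1 n).powerset | 4 * #S ≤ n} := by
    intro C hC
    simp only [hS, mem_filter] at hC ⊢
    exact ⟨hC.1, hC.2.1⟩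
  have hSdep : ∀ C ∈ S, ¬ M.Indep C := fun C hC => (mem_filter.1 hC).2.2
  -- The non-bases left for `H` to certify; `hbig` shows that their circuits have more than `n / 4`
  -- elements.
  set 𝒳 : Finset (Finset ℕ) := {X ∈ powersetCard r (Icc 1 n) | ¬ M.Indep X ∧
    (∃ e ∈ X, M.Indep (X.erase e)) ∧ ∀ C ∈ S, ¬ C ⊆ X} with h𝒳
  have hbig : ∀ X ∈ 𝒳, n < 4 * #{x ∈ X | M.Indep (X.erase x)} := by
    intro X hX
    obtain ⟨hXr, hXdep, ⟨e, he, hXe⟩, hXS⟩ := mem_filter.1 hX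
    rw [mem_powersetCard] at hXr
    have hdep := not_indep_filter_erase (hE ▸ coe_subset.2 hXr.1) hXdep he hXe
    by_contra hlt
    refine hXS {x ∈ X | M.Indep (X.erase x)} ?_ (filter_subset _ X)
    exact mem_filter.2 ⟨mem_powerset.2 ((filter_subset _ X).trans hXr.1), by omega, hdep⟩
  have hcover : ∀ H : Finset (Finset ℕ), (∀ X ∈ 𝒳, ∃ K ∈ H, X ⊆ K) →
      ∀ X : Finset ℕ, (X : Set ℕ) ⊆ M.E → #X = #B → ¬ M.Indep X →
      (∃ e ∈ X, M.Indep (X.erase e)) → (∃ C ∈ S, C ⊆ X) ∨ ∃ K ∈ H, X ⊆ K := by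
    intro H hH X hXE hXB hX he
    by_cases hC : ∃ C ∈ S, C ⊆ X
    · exact Or.inl hC
    · push Not at hC
      rw [hE, coe_subset] at hXE
      exact Or.inr (hH X (mem_filter.2 ⟨mem_powersetCard.2 ⟨hXE, hXB⟩, hX, he, hC⟩))
  -- For `r < s` the family `𝒳` is empty: a circuit inside a set of `r < s ≤ n / 8` elements cannot
  -- have more than `n / 4` elements.
  rcases lt_or_ge r s with hrs | hrs
  · refine ⟨B, mem_powerset.2 hBE, S, hSsub, ∅, empty_subset _,
      ⟨hB, hSdep, by simp, hcover ∅ fun X hX => ?_⟩, by simp; positivity⟩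
    have h1 := hbig X hX
    have h2 := (mem_powersetCard.1 (mem_filter.1 hX).1).2
    have h3 := card_filter_le X (fun x => M.Indep (X.erase x))
    omega
  · let R : Finset ℕ → Finset ℕ → Prop := fun X T =>
      T ⊆ X ∧ M.Indep T ∧ ∀ y ∈ X \ T, M.Indep (X.erase y)
    have hR : ∀ X ∈ 𝒳, d ≤ #{T ∈ powersetCard (r - s) (Icc 1 n) | R X T} := by
      intro X hX
      obtain ⟨hXI, hXr⟩ := mem_powersetCard.1 (mem_filter.1 hX).1
      refine (pow_div_factorial_le_choose hn (hbig X hX)).trans ?_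
      rw [← card_powersetCard]
      norm_cast
      -- Distinct `s`-subsets `Y` of the circuit in `X` give distinct sets `X \ Y` related to `X`.
      refine card_le_card_of_injOn (fun Y => X \ Y) ?_ ?_
      · intro Y hY
        obtain ⟨hYC, hYs⟩ := mem_powersetCard.1 (mem_coe.1 hY)
        have hYX : Y ⊆ X := hYC.trans (filter_subset _ _)
        refine mem_coe.2 (mem_filter.2 ⟨mem_powersetCard.2 ⟨sdiff_subset.trans hXI, ?_⟩,
          sdiff_subset, ?_, ?_⟩)
        · rw [card_sdiff_of_subset hYX]; omega
        · obtain ⟨y, hy⟩ : Y.Nonempty := card_pos.1 (by omega)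
          refine (mem_filter.1 (hYC hy)).2.subset (coe_subset.2 fun x hx => ?_)
          rw [mem_sdiff] at hx
          exact mem_erase.2 ⟨fun h => hx.2 (h ▸ hy), hx.1⟩
        · intro y hy
          rw [Finset.sdiff_sdiff_eq_self hYX] at hy
          exact (mem_filter.1 (hYC hy)).2
      · intro Y hY Y' hY' h
        have hYX : Y ⊆ X := (mem_powersetCard.1 (mem_coe.1 hY)).1.trans (filter_subset _ _)
        have hYX' : Y' ⊆ X := (mem_powersetCard.1 (mem_coe.1 hY')).1.trans (filter_subset _ _)
        simp only at h
        rw [← Finset.sdiff_sdiff_eq_self hYX, h, Finset.sdiff_sdiff_eq_self hYX']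
    obtain ⟨𝒯, h𝒯, h𝒯k, hU⟩ := exists_hitting 𝒳 _ R d hR k
    set U := {X ∈ 𝒳 | ∀ T ∈ 𝒯, ¬ R X T} with hUdef
    -- Stated for every `T`, with `∅` as default, so that `choose` yields a total function.
    have hloc : ∀ T : Finset ℕ, ∃ H ⊆ (Icc 1 n).powerset, #H ≤ c * n ^ (s - 2) ∧
        (∀ K ∈ H, ∀ I ⊆ K, ¬ M.IsBase I) ∧ (M.Indep T → #T = r - s → ∀ Y : Finset ℕ,
          (Y : Set ℕ) ⊆ M.E → #Y = s → Disjoint T Y →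
          (∀ y ∈ Y, M.Indep (T ∪ Y.erase y : Finset ℕ)) →
          ¬ M.Indep (T ∪ Y : Finset ℕ) → ∃ K ∈ H, T ∪ Y ⊆ K) := by
      intro T
      by_cases hT : M.Indep T ∧ #T = r - s
      · obtain ⟨H, h1, h2, h3, h4⟩ := hN n (by omega) M hM T hT.1
          (fun B' hB' => by have := card_eq_of_isBase hB hB'; omega)
        exact ⟨H, h1, h2, h3, fun _ _ => h4⟩
      · exact ⟨∅, by simp, by simp, by simp, fun h1 h2 => absurd ⟨h1, h2⟩ hT⟩
    choose h h1 h2 h3 h4 using hloc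
    -- The missed non-bases `U` enter `H` themselves: each has `r` elements and is dependent, so it
    -- contains no base.
    refine ⟨B, mem_powerset.2 hBE, S, hSsub, 𝒯.biUnion h ∪ U, ?_, ⟨hB, hSdep, ?_, ?_⟩, ?_⟩
    · refine union_subset (biUnion_subset.2 fun T _ => h1 T) fun X hX => ?_
      exact mem_powerset.2 (mem_powersetCard.1 (mem_filter.1 (mem_filter.1 hX).1).1).1
    · intro K hK I hIK hI
      rcases mem_union.1 hK with hK | hK
      · obtain ⟨T, -, hKT⟩ := mem_biUnion.1 hK
        exact h3 T K hKT I hIK hI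
      · obtain ⟨hKr, hKdep, -⟩ := mem_filter.1 (mem_filter.1 hK).1
        have hIK' : I = K := eq_of_subset_of_card_le hIK
          (by rw [(mem_powersetCard.1 hKr).2, hr, card_eq_of_isBase hB hI])
        exact hKdep (hIK' ▸ hI.indep)
    · refine hcover _ fun X hX => ?_
      by_cases hXU : ∀ T ∈ 𝒯, ¬ R X T
      · exact ⟨X, mem_union_right _ (mem_filter.2 ⟨hX, hXU⟩), Subset.rfl⟩
      · push Not at hXU
        obtain ⟨T, hT, hTX, hTi, hTe⟩ := hXU
        obtain ⟨hXr, hXdep, -⟩ := mem_filter.1 hX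
        obtain ⟨hXI, hXr⟩ := mem_powersetCard.1 hXr
        have hTr := (mem_powersetCard.1 (h𝒯 hT)).2
        have hunion : T ∪ X \ T = X := union_sdiff_of_subset hTX
        obtain ⟨K, hK, hXK⟩ := h4 T hTi hTr (X \ T)
          (hE ▸ coe_subset.2 (sdiff_subset.trans hXI))
          (by rw [card_sdiff_of_subset hTX]; omega) disjoint_sdiff
          (fun y hy => by
            have : T ∪ (X \ T).erase y = X.erase y := by
              ext x
              simp only [mem_union, mem_erase, mem_sdiff] at hy ⊢
              constructor
              · rintro (hx | hx)
                · exact ⟨fun h => hy.2 (h ▸ hx), hTX hx⟩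
                · exact ⟨hx.1, hx.2.1⟩
              · rintro ⟨hx, hx'⟩
                by_cases hxT : x ∈ T
                · exact Or.inl hxT
                · exact Or.inr ⟨hx, hx', hxT⟩
            rw [this]; exact hTe y hy)
          (by rwa [hunion])
        rw [hunion] at hXK
        exact ⟨K, mem_union_left _ (mem_biUnion.2 ⟨T, hT, hK⟩), hXK⟩
    · have hA : (#(powersetCard (r - s) (Icc 1 n)) : ℝ) ≤ 2 ^ n / √n := by
        rw [card_powersetCard, Nat.card_Icc, le_div_iff₀ hn0]
        exact choose_mul_sqrt_le _ _
      have hX : (#𝒳 : ℝ) ≤ 2 ^ n / √n := by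
        refine le_trans (Nat.cast_le.2 (card_filter_le _ _)) ?_
        rw [card_powersetCard, Nat.card_Icc, le_div_iff₀ hn0]
        exact choose_mul_sqrt_le _ _
      have hcard : #(𝒯.biUnion h ∪ U) ≤ k * (c * n ^ (s - 2)) + #U := by
        refine (card_union_le _ _).trans (Nat.add_le_add_right ?_ _)
        exact (card_biUnion_le_card_mul _ _ _ fun T _ => h2 T).trans (Nat.mul_le_mul_right _ h𝒯k)
      have hd0 : 0 ≤ d := by positivity
      have hApos : (0 : ℝ) < #(powersetCard (r - s) (Icc 1 n)) := by
        rw [card_powersetCard, Nat.card_Icc]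
        have : r ≤ n := by simpa using card_le_card hBE
        exact_mod_cast Nat.choose_pos (by omega)
      have hexp : d * √n / 2 ^ n ≤ d / #(powersetCard (r - s) (Icc 1 n)) := by
        calc d * √n / 2 ^ n = d / (2 ^ n / √n) := by field_simp
          _ ≤ _ := div_le_div_of_nonneg_left hd0 hApos hA
      calc (#(𝒯.biUnion h ∪ U) : ℝ) ≤ k * (c * n ^ (s - 2) : ℕ) + #U := by exact_mod_cast hcard
        _ ≤ _ := by
          refine add_le_add le_rfl (hU.trans ?_)
          refine mul_le_mul hX (Real.exp_le_exp.2 ?_) (Real.exp_pos _).le (by positivity)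
          exact mul_le_mul_of_nonneg_right (neg_le_neg hexp) (Nat.cast_nonneg _)

/-! ### Counting codes and the asymptotic estimate. -/

open Classical in
theorem ncard_exOn_le {β : Type*} {N : Matroid β} {n m : ℕ}
    (h : ∀ M ∈ exOn N n, ∃ B ∈ (Icc 1 n).powerset,
      ∃ S ⊆ {S ∈ (Icc 1 n).powerset | 4 * #S ≤ n}, ∃ H ⊆ (Icc 1 n).powerset,
        IsCode M B S H ∧ #H ≤ m) :
    (exOn N n).ncard ≤ 2 ^ n * 2 ^ #{S ∈ (Icc 1 n).powerset | 4 * #S ≤ n} *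
      #{H ∈ (Icc 1 n).powerset.powerset | #H ≤ m} := by
  choose! B hB S hS H hH hcode hm using h
  set codes := (Icc 1 n).powerset ×ˢ ({S ∈ (Icc 1 n).powerset | 4 * #S ≤ n} : Finset _).powerset ×ˢ
    ({H ∈ (Icc 1 n).powerset.powerset | #H ≤ m} : Finset _) with hcodes
  have hcard : #codes = 2 ^ n * 2 ^ #{S ∈ (Icc 1 n).powerset | 4 * #S ≤ n} *
      #{H ∈ (Icc 1 n).powerset.powerset | #H ≤ m} := by
    rw [hcodes, card_product, card_product, card_powerset, card_powerset, Nat.card_Icc, mul_assoc]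
    rfl
  rw [← hcard, ← Set.ncard_coe_finset]
  refine Set.ncard_le_ncard_of_injOn (fun M => (B M, S M, H M)) ?_ ?_ codes.finite_toSet
  · intro M hM
    simp only [hcodes, coe_product, Set.mem_prod, mem_coe, mem_powerset, mem_filter]
    exact ⟨mem_powerset.1 (hB M hM), hS M hM, hH M hM, hm M hM⟩
  · intro M hM M' hM' heq
    simp only [Prod.mk.injEq] at heq
    have h1 := hcode M hM
    rw [heq.1, heq.2.1, heq.2.2] at h1
    exact h1.eq (hcode M' hM') (hM.1.trans hM'.1.symm)

theorem logb_ncard_exOn_le {β : Type*} {N : Matroid β} {n m : ℕ}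
    (h : ∀ M ∈ exOn N n, ∃ B ∈ (Icc 1 n).powerset,
      ∃ S ⊆ {S ∈ (Icc 1 n).powerset | 4 * #S ≤ n}, ∃ H ⊆ (Icc 1 n).powerset,
        IsCode M B S H ∧ #H ≤ m) {x : ℝ} (hx : 0 < x) (hx1 : x ≤ 1) :
    Real.logb 2 ((exOn N n).ncard : ℝ) ≤
      n + (9 / 5) ^ n + m * Real.logb 2 x⁻¹ + 2 * x * 2 ^ n := by
  classical
  have hle := ncard_exOn_le h
  have hL0 : 0 ≤ Real.logb 2 x⁻¹ := Real.logb_nonneg (by norm_num) ((one_le_inv₀ hx).2 hx1)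
  rcases Nat.eq_zero_or_pos (exOn N n).ncard with h0 | h0
  · rw [h0]; simp only [Nat.cast_zero, Real.logb_zero]; positivity
  set a := #{S ∈ (Icc 1 n).powerset | 4 * #S ≤ n} with ha
  set F := #{H ∈ (Icc 1 n).powerset.powerset | #H ≤ m} with hF
  have haR : (a : ℝ) ≤ (9 / 5) ^ n := by simpa using card_small_subsets_le (Icc 1 n)
  have hFpos : (0 : ℝ) < F := by
    have : 0 < F := Nat.pos_of_ne_zero fun h => by rw [h] at hle; omega
    exact_mod_cast this
  have hFR : (F : ℝ) * x ^ m ≤ (1 + x) ^ (2 ^ n) := by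
    simpa using card_powerset_filter_mul_pow_le (Icc 1 n).powerset m hx hx1
  have hFlog : Real.logb 2 F ≤ m * Real.logb 2 x⁻¹ + 2 * x * 2 ^ n := by
    have h1 := Real.logb_le_logb_of_le (b := 2) (by norm_num) (by positivity) hFR
    rw [Real.logb_mul hFpos.ne' (by positivity), Real.logb_pow, Real.logb_pow] at h1
    rw [Real.logb_inv]
    -- From `log (1 + x) ≤ x` and `log 2 > 1/2`.
    have h2 : Real.logb 2 (1 + x) ≤ 2 * x := by
      rw [Real.logb, div_le_iff₀ (Real.log_pos (by norm_num))]
      have h3 := Real.log_le_sub_one_of_pos (show 0 < 1 + x by linarith)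
      have h4 := Real.log_two_gt_d9
      nlinarith
    have h5 := mul_le_mul_of_nonneg_left h2 (show (0 : ℝ) ≤ ((2 ^ n : ℕ) : ℝ) by positivity)
    push_cast at h1 h5
    linarith
  have hle' : ((exOn N n).ncard : ℝ) ≤ 2 ^ n * 2 ^ a * F := by exact_mod_cast hle
  calc Real.logb 2 ((exOn N n).ncard : ℝ) ≤ Real.logb 2 (2 ^ n * 2 ^ a * F) :=
        Real.logb_le_logb_of_le (by norm_num) (by exact_mod_cast h0) hle'
    _ = n + a + Real.logb 2 F := by
        rw [Real.logb_mul (by positivity) hFpos.ne', Real.logb_mul (by positivity) (by positivity),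
          Real.logb_pow, Real.logb_pow, Real.logb_self_eq_one (by norm_num), mul_one, mul_one]
    _ ≤ _ := by linarith

theorem eventually_mul_pow_mul_pow_le_one (c : ℝ) (k : ℕ) {q : ℝ} (hq : |q| < 1) :
    ∀ᶠ n : ℕ in Filter.atTop, c * ((n : ℝ) ^ k * q ^ n) ≤ 1 := by
  have h := (tendsto_pow_const_mul_const_pow_of_abs_lt_one k hq).const_mul c
  rw [mul_zero] at h
  exact h.eventually_le_const one_pos

theorem FlatSparse.smallExcluded {β : Type*} {N : Matroid β} {s c : ℕ} (hs : 2 ≤ s)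
    (hN : FlatSparse N s c) : SmallExcluded N := by
  set D : ℝ := 8 ^ s * s.factorial with hD
  have hD0 : 0 < D := by positivity
  -- The part `6 * c * D + 6` is `3 * (2 * c * D + 2)`, from naming the members of `H`. The
  -- remaining 4 pays for `n`, `(9/5) ^ n` and `2 * 2 ^ n / n ^ 3`.
  refine Asymptotics.IsBigO.of_bound (6 * c * D + 10) ?_
  filter_upwards [Filter.eventually_ge_atTop (8 * s),
    eventually_mul_pow_mul_pow_le_one 1 4 (q := 1 / 2) (by norm_num [abs_of_pos]),
    eventually_mul_pow_mul_pow_le_one 1 3 (q := 9 / 10) (by norm_num [abs_of_pos]),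
    eventually_mul_pow_mul_pow_le_one c (s + 1) (q := 1 / 2) (by norm_num [abs_of_pos])]
    with n hn h1 h2 h3
  have hn2 : 2 ≤ n := by omega
  have hn2R : (2 : ℝ) ≤ n := by exact_mod_cast hn2
  have hn0 : (0 : ℝ) < n := by linarith
  have hsq : 0 < √(n : ℝ) := Real.sqrt_pos.2 hn0
  set L := Real.logb 2 (n : ℝ) with hL
  have hL1 : 1 ≤ L := by
    rw [hL, Real.le_logb_iff_rpow_le (by norm_num) hn0]; simpa using hn2R
  have hlnL : Real.log n ≤ L := by
    rw [hL, Real.logb, le_div_iff₀ (Real.log_pos (by norm_num))]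
    have := Real.log_nonneg (show (1 : ℝ) ≤ n by linarith)
    have := Real.log_two_lt_d9
    nlinarith
  have hln0 : 0 ≤ Real.log n := Real.log_nonneg (by linarith)
  have hrpow : (n : ℝ) ^ (5 / 2 : ℝ) = n ^ 2 * √n := by
    rw [Real.sqrt_eq_rpow, ← Real.rpow_natCast, ← Real.rpow_add hn0]; norm_num
  rw [hrpow]
  set g : ℝ := 2 ^ n / (n ^ 2 * √n) with hg
  have hg0 : 0 < g := by positivity
  have hcube : (2 : ℝ) ^ n / n ^ 3 ≤ g := by
    rw [hg]
    refine div_le_div_of_nonneg_left (by positivity) (by positivity) ?_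
    have : √(n : ℝ) ≤ n := Real.sqrt_le_self_iff.2 (Or.inr (by linarith))
    nlinarith [sq_nonneg (n : ℝ)]
  have hhalf : ∀ y : ℝ, y * (n ^ 3 * (1 / 2) ^ n) ≤ 1 → y ≤ g := by
    intro y hy
    refine le_trans ?_ hcube
    rw [le_div_iff₀ (by positivity)]
    rw [one_div, inv_pow, ← mul_assoc, ← div_eq_mul_inv, div_le_one (by positivity)] at hy
    exact hy
  have hng : (n : ℝ) ≤ g := hhalf _ (by convert h1 using 1; ring)
  have hcg : (c * n ^ (s - 2) : ℝ) ≤ g := hhalf _ (by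
    convert h3 using 1
    rw [show s + 1 = (s - 2) + 3 by omega, pow_add]; ring)
  have h95 : (9 / 5 : ℝ) ^ n ≤ g := by
    refine hhalf _ (le_trans (le_of_eq ?_) h2)
    rw [one_mul, mul_left_comm, ← mul_pow]; norm_num
  set d : ℝ := (n / 8 : ℝ) ^ s / s.factorial with hd
  have hdD : d = n ^ s / D := by rw [hd, hD, div_pow, div_div]
  have hd0 : 0 < d := by rw [hdD]; positivity
  set q : ℝ := d * √n / 2 ^ n with hq
  have hq0 : 0 < q := by positivity
  -- The least `k` for which the missed fraction `exp (-q * k)` is guaranteed to be at most `1 / n ^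
  -- 2`, turning `2 ^ n / √n` into `g`.
  set k : ℕ := ⌈2 * Real.log n / q⌉₊ with hk
  have hk1 : 2 * Real.log n / q ≤ k := Nat.le_ceil _
  have hk2 : (k : ℝ) ≤ 2 * Real.log n / q + 1 :=
    (Nat.ceil_lt_add_one (by positivity)).le
  have hexp : Real.exp (-q * k) ≤ ((n : ℝ) ^ 2)⁻¹ := by
    rw [← Real.log_le_log_iff (Real.exp_pos _) (by positivity), Real.log_exp, Real.log_inv,
      Real.log_pow]
    rw [div_le_iff₀ hq0] at hk1
    push_cast
    linarith
  set R : ℝ := k * (c * n ^ (s - 2) : ℕ) + 2 ^ n / √n * Real.exp (-q * k) with hR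
  have hRg : R ≤ (2 * c * D + 2) * (L * g) := by
    have e1 : (k : ℝ) * (c * n ^ (s - 2) : ℕ) ≤ 2 * c * D * (L * g) + g := by
      have hpos : (0 : ℝ) ≤ (c * n ^ (s - 2) : ℕ) := Nat.cast_nonneg _
      have e2 := mul_le_mul_of_nonneg_right hk2 hpos
      have e3 : 2 * Real.log n / q * (c * n ^ (s - 2) : ℕ) = 2 * c * D * (Real.log n * g) := by
        rw [hq, hdD, hg]
        push_cast
        have : (n : ℝ) ^ s = n ^ (s - 2) * n ^ 2 := by rw [← pow_add]; congr 1; omega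
        rw [this]
        field_simp
      have e4 : Real.log n * g ≤ L * g := mul_le_mul_of_nonneg_right hlnL hg0.le
      have e5 := mul_le_mul_of_nonneg_left e4 (show 0 ≤ 2 * c * D by positivity)
      rw [add_mul, e3] at e2
      push_cast at e2 ⊢
      linarith
    have e6 : 2 ^ n / √n * Real.exp (-q * k) ≤ g := by
      calc (2 : ℝ) ^ n / √n * Real.exp (-q * k) ≤ 2 ^ n / √n * ((n : ℝ) ^ 2)⁻¹ :=
            mul_le_mul_of_nonneg_left hexp (by positivity)
        _ = g := by rw [hg]; field_simp
    have e7 : g ≤ L * g := le_mul_of_one_le_left hg0.le hL1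
    rw [hR]
    linarith
  have hR0 : 0 ≤ R := by positivity
  -- With `x = n ^ (-3)` a member of `H` costs `3 * log n` bits, and the error `2 * x * 2 ^ n` stays
  -- below the order of `g`.
  have hmain := logb_ncard_exOn_le (N := N) (n := n) (m := ⌊R⌋₊) (x := ((n : ℝ) ^ 3)⁻¹)
    (fun M hM => by
      obtain ⟨B, hB, S, hS, H, hH, hcode, hcard⟩ := exists_isCode (by omega) hN hn hM k
      exact ⟨B, hB, S, hS, H, hH, hcode, Nat.le_floor hcard⟩)
    (by positivity) (inv_le_one_of_one_le₀ (one_le_pow₀ (by linarith)))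
  rw [inv_inv, Real.logb_pow] at hmain
  have hfloor : (⌊R⌋₊ : ℝ) ≤ (2 * c * D + 2) * (L * g) := (Nat.floor_le hR0).trans hRg
  have hge : g ≤ g * L ^ 2 := le_mul_of_one_le_right hg0.le (one_le_pow₀ hL1)
  rw [Real.norm_of_nonneg (by positivity : 0 ≤ g * L ^ 2), Real.norm_of_nonneg (by
    rcases Nat.eq_zero_or_pos (exOn N n).ncard with h0 | h0
    · simp [h0]
    · exact Real.logb_nonneg (by norm_num) (by exact_mod_cast h0))]
  have hx : 2 * ((n : ℝ) ^ 3)⁻¹ * 2 ^ n = 2 * (2 ^ n / n ^ 3) := by field_simp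
  have hm := mul_le_mul_of_nonneg_right hfloor (show 0 ≤ ((3 : ℕ) : ℝ) * L by positivity)
  have hm' : (2 * c * D + 2) * (L * g) * (((3 : ℕ) : ℝ) * L) = (6 * c * D + 6) * (g * L ^ 2) := by
    push_cast; ring
  rw [hx, ← hL] at hmain
  rw [hm'] at hm
  generalize g * L ^ 2 = G at hm hge ⊢
  generalize (⌊R⌋₊ : ℝ) * (((3 : ℕ) : ℝ) * L) = u at hm hmain
  generalize (2 : ℝ) ^ n / (n : ℝ) ^ 3 = v at hcube hmain
  have : (6 * c * D + 10) * G = (6 * c * D + 6) * G + 4 * G := by ring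
  linarith

/-! ### Linear spaces and six-point configurations. -/

/-- `ln x y` is the line through two distinct points `x`, `y` of the linear space on `S`. -/
structure LinearSpace {α : Type*} (S : Finset α) (ln : α → α → Finset α) : Prop where
  subset : ∀ {x y}, x ∈ S → y ∈ S → x ≠ y → ln x y ⊆ S
  left : ∀ {x y}, x ∈ S → y ∈ S → x ≠ y → x ∈ ln x y
  right : ∀ {x y}, x ∈ S → y ∈ S → x ≠ y → y ∈ ln x y
  eq : ∀ {x y u v}, x ∈ S → y ∈ S → x ≠ y → u ∈ ln x y → v ∈ ln x y → u ≠ v → ln u v = ln x y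

def IsLine {α : Type*} (S : Finset α) (ln : α → α → Finset α) (L : Finset α) : Prop :=
  ∃ x ∈ S, ∃ y ∈ S, x ≠ y ∧ ln x y = L

/-- The lines with at least three points. -/
def longLines {α : Type*} [DecidableEq α] (S : Finset α) (ln : α → α → Finset α) :
    Finset (Finset α) :=
  {L ∈ S.offDiag.image fun p => ln p.1 p.2 | 3 ≤ #L}

/-- Six points of the linear space whose collinear triples are those in `C`. -/
def HasConfig {α : Type*} (S : Finset α) (ln : α → α → Finset α) (C : Finset (Finset (Fin 6))) :
    Prop :=
  ∃ f : Fin 6 → α, Function.Injective f ∧ (∀ i, f i ∈ S) ∧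
    ∀ i j k, i < j → j < k → (f k ∈ ln (f i) (f j) ↔ {i, j, k} ∈ C)

theorem forall_triples {P : Fin 6 → Fin 6 → Fin 6 → Prop} (h012 : P 0 1 2) (h013 : P 0 1 3)
    (h014 : P 0 1 4) (h015 : P 0 1 5) (h023 : P 0 2 3) (h024 : P 0 2 4) (h025 : P 0 2 5)
    (h034 : P 0 3 4) (h035 : P 0 3 5) (h045 : P 0 4 5) (h123 : P 1 2 3) (h124 : P 1 2 4)
    (h125 : P 1 2 5) (h134 : P 1 3 4) (h135 : P 1 3 5) (h145 : P 1 4 5) (h234 : P 2 3 4)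
    (h235 : P 2 3 5) (h245 : P 2 4 5) (h345 : P 3 4 5) :
    ∀ i j k, i < j → j < k → P i j k := by
  intro i j k hij hjk
  fin_cases i <;> fin_cases j <;>
    first
    | exact absurd hij (by decide)
    | (fin_cases k <;> first | exact absurd hjk (by decide) | assumption)

section LinearSpaces

variable {α : Type*} {S : Finset α} {ln : α → α → Finset α}

theorem injective_six {a b c d e f : α} (h : [a, b, c, d, e, f].Nodup) :
    Function.Injective ![a, b, c, d, e, f] := by
  rw [← List.nodup_ofFn]
  simpa [List.ofFn_succ] using h

theorem forall_six {P : α → Prop} {a b c d e f : α} (ha : P a) (hb : P b) (hc : P c) (hd : P d)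
    (he : P e) (hf : P f) : ∀ i, P (![a, b, c, d, e, f] i) := by
  intro i; fin_cases i <;> assumption

namespace LinearSpace

theorem isLine {x y : α} (hx : x ∈ S) (hy : y ∈ S) (hxy : x ≠ y) :
    IsLine S ln (ln x y) := ⟨x, hx, y, hy, hxy, rfl⟩

theorem line_subset (h : LinearSpace S ln) {L : Finset α} (hL : IsLine S ln L) : L ⊆ S := by
  obtain ⟨x, hx, y, hy, hxy, rfl⟩ := hL
  exact h.subset hx hy hxy

theorem line_eq (h : LinearSpace S ln) {L : Finset α} (hL : IsLine S ln L) {u v : α} (hu : u ∈ L)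
    (hv : v ∈ L) (huv : u ≠ v) : ln u v = L := by
  obtain ⟨x, hx, y, hy, hxy, rfl⟩ := hL
  exact h.eq hx hy hxy hu hv huv

theorem lines_eq (h : LinearSpace S ln) {L L' : Finset α} (hL : IsLine S ln L)
    (hL' : IsLine S ln L') {u v : α} (hu : u ∈ L) (hv : v ∈ L) (hu' : u ∈ L') (hv' : v ∈ L')
    (huv : u ≠ v) : L = L' :=
  (h.line_eq hL hu hv huv).symm.trans (h.line_eq hL' hu' hv' huv)

theorem notMem_right (h : LinearSpace S ln) {L : Finset α} (hL : IsLine S ln L) {x y z : α}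
    (hx : x ∈ L) (hy : y ∈ L) (hxy : x ≠ y) (hz : z ∉ L) : z ∉ ln x y := by
  rwa [h.line_eq hL hx hy hxy]

/-- `HasConfig` tests the last point of a triple against the line through the first two; this
handles triples whose off-line point comes first. -/
theorem notMem_left (h : LinearSpace S ln) {L : Finset α} (hL : IsLine S ln L) {x y z : α}
    (hx : x ∈ L) (hy : y ∈ L) (hxy : x ≠ y) (hz : z ∉ L) (hzS : z ∈ S) : y ∉ ln z x := by
  intro hmem
  have hxS := h.line_subset hL hx
  have hzx : z ≠ x := fun e => hz (e ▸ hx)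
  refine hz ?_
  rw [h.lines_eq hL (isLine hzS hxS hzx) hx hy (h.right hzS hxS hzx) hmem hxy]
  exact h.left hzS hxS hzx

theorem hasConfig_P6 {a b c d e f : α} (hS : a ∈ S ∧ b ∈ S ∧ c ∈ S ∧ d ∈ S ∧ e ∈ S ∧ f ∈ S)
    (hnd : [a, b, c, d, e, f].Nodup) (habc : c ∈ ln a b)
    (hab : d ∉ ln a b ∧ e ∉ ln a b ∧ f ∉ ln a b) (hac : d ∉ ln a c ∧ e ∉ ln a c ∧ f ∉ ln a c)
    (hbc : d ∉ ln b c ∧ e ∉ ln b c ∧ f ∉ ln b c) (ha : e ∉ ln a d ∧ f ∉ ln a d ∧ f ∉ ln a e)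
    (hb : e ∉ ln b d ∧ f ∉ ln b d ∧ f ∉ ln b e) (hc : e ∉ ln c d ∧ f ∉ ln c d ∧ f ∉ ln c e)
    (hdef : f ∉ ln d e) : HasConfig S ln {{0, 1, 2}} := by
  obtain ⟨hSa, hSb, hSc, hSd, hSe, hSf⟩ := hS
  exact ⟨![a, b, c, d, e, f], injective_six hnd, forall_six hSa hSb hSc hSd hSe hSf,
    forall_triples (iff_of_true habc (by decide)) (iff_of_false hab.1 (by decide))
    (iff_of_false hab.2.1 (by decide)) (iff_of_false hab.2.2 (by decide))
    (iff_of_false hac.1 (by decide)) (iff_of_false hac.2.1 (by decide))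
    (iff_of_false hac.2.2 (by decide)) (iff_of_false ha.1 (by decide))
    (iff_of_false ha.2.1 (by decide)) (iff_of_false ha.2.2 (by decide))
    (iff_of_false hbc.1 (by decide)) (iff_of_false hbc.2.1 (by decide))
    (iff_of_false hbc.2.2 (by decide)) (iff_of_false hb.1 (by decide))
    (iff_of_false hb.2.1 (by decide)) (iff_of_false hb.2.2 (by decide))
    (iff_of_false hc.1 (by decide)) (iff_of_false hc.2.1 (by decide))
    (iff_of_false hc.2.2 (by decide)) (iff_of_false hdef (by decide))⟩

theorem hasConfig_Q6 (h : LinearSpace S ln) {L L' : Finset α} (hL : IsLine S ln L)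
    (hL' : IsLine S ln L') {p a b c d e : α} (hp : p ∈ L) (hp' : p ∈ L') (ha : a ∈ L) (hb : b ∈ L)
    (hc : c ∈ L') (hd : d ∈ L') (heS : e ∈ S) (hpa : p ≠ a) (hpb : p ≠ b) (hab : a ≠ b)
    (hpc : p ≠ c) (hpd : p ≠ d) (hcd : c ≠ d) (ha' : a ∉ L') (hb' : b ∉ L') (hc' : c ∉ L)
    (hd' : d ∉ L) (he : e ∉ L) (he' : e ∉ L') (hac : e ∉ ln a c) (had : e ∉ ln a d)
    (hbc : e ∉ ln b c) (hbd : e ∉ ln b d) :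
    HasConfig S ln {{0, 1, 2}, {0, 3, 4}} := by
  have hLS := h.line_subset hL
  have hLS' := h.line_subset hL'
  have hac' : a ≠ c := fun e => hc' (e ▸ ha)
  have had' : a ≠ d := fun e => hd' (e ▸ ha)
  have hae' : a ≠ e := fun e => he (e ▸ ha)
  have hbc' : b ≠ c := fun e => hc' (e ▸ hb)
  have hbd' : b ≠ d := fun e => hd' (e ▸ hb)
  have hbe' : b ≠ e := fun e => he (e ▸ hb)
  have hpe' : p ≠ e := fun e => he (e ▸ hp)
  have hce' : c ≠ e := fun e => he' (e ▸ hc)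
  have hde' : d ≠ e := fun e => he' (e ▸ hd)
  exact ⟨![p, a, b, c, d, e], injective_six (by simp [*]),
    forall_six (hLS hp) (hLS ha) (hLS hb) (hLS' hc) (hLS' hd) heS,
    forall_triples (iff_of_true (h.line_eq hL hp ha hpa ▸ hb) (by decide))
    (iff_of_false (h.notMem_right hL hp ha hpa hc') (by decide))
    (iff_of_false (h.notMem_right hL hp ha hpa hd') (by decide))
    (iff_of_false (h.notMem_right hL hp ha hpa he) (by decide))
    (iff_of_false (h.notMem_right hL hp hb hpb hc') (by decide))
    (iff_of_false (h.notMem_right hL hp hb hpb hd') (by decide))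
    (iff_of_false (h.notMem_right hL hp hb hpb he) (by decide))
    (iff_of_true (h.line_eq hL' hp' hc hpc ▸ hd) (by decide))
    (iff_of_false (h.notMem_right hL' hp' hc hpc he') (by decide))
    (iff_of_false (h.notMem_right hL' hp' hd hpd he') (by decide))
    (iff_of_false (h.notMem_right hL ha hb hab hc') (by decide))
    (iff_of_false (h.notMem_right hL ha hb hab hd') (by decide))
    (iff_of_false (h.notMem_right hL ha hb hab he) (by decide))
    (iff_of_false (h.notMem_left hL' hc hd hcd ha' (hLS ha)) (by decide))
    (iff_of_false hac (by decide)) (iff_of_false had (by decide))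
    (iff_of_false (h.notMem_left hL' hc hd hcd hb' (hLS hb)) (by decide))
    (iff_of_false hbc (by decide)) (iff_of_false hbd (by decide))
    (iff_of_false (h.notMem_right hL' hc hd hcd he') (by decide))⟩

theorem hasConfig_U36 (h : LinearSpace S ln) {a b c d e f : α}
    (hS : a ∈ S ∧ b ∈ S ∧ c ∈ S ∧ d ∈ S ∧ e ∈ S ∧ f ∈ S) (hab : a ≠ b)
    (hc : c ∉ ln a b) (hd : d ∉ ln a b ∧ d ∉ ln a c ∧ d ∉ ln b c)
    (he : e ∉ ln a b ∧ e ∉ ln a c ∧ e ∉ ln b c ∧ e ∉ ln a d ∧ e ∉ ln b d ∧ e ∉ ln c d)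
    (hf : f ∉ ln a b ∧ f ∉ ln a c ∧ f ∉ ln b c ∧ f ∉ ln a d ∧ f ∉ ln b d ∧ f ∉ ln c d ∧
      f ∉ ln a e ∧ f ∉ ln b e ∧ f ∉ ln c e ∧ f ∉ ln d e) :
    HasConfig S ln ∅ := by
  obtain ⟨hSa, hSb, hSc, hSd, hSe, hSf⟩ := hS
  have key : ∀ {x y z}, x ∈ S → y ∈ S → x ≠ y → z ∉ ln x y → x ≠ z ∧ y ≠ z :=
    fun hx hy hxy hz => ⟨fun e => hz (e ▸ h.left hx hy hxy), fun e => hz (e ▸ h.right hx hy hxy)⟩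
  have h1 := key hSa hSb hab hc
  have h2 := key hSa hSb hab hd.1
  have h3 := key hSa hSc h1.1 hd.2.1
  have h4 := key hSa hSb hab he.1
  have h5 := key hSc hSd h3.2 he.2.2.2.2.2
  have h6 := key hSa hSb hab hf.1
  have h7 := key hSc hSd h3.2 hf.2.2.2.2.2.1
  have h8 := key hSd hSe h5.2 hf.2.2.2.2.2.2.2.2.2
  refine ⟨![a, b, c, d, e, f], injective_six (by simp [*]),
    forall_six hSa hSb hSc hSd hSe hSf, ?_⟩
  simp only [notMem_empty, iff_false]
  exact forall_triples hc hd.1 he.1 hf.1 hd.2.1 he.2.1 hf.2.1 he.2.2.2.1 hf.2.2.2.1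
    hf.2.2.2.2.2.2.1 hd.2.2 he.2.2.1 hf.2.2.1 he.2.2.2.2.1 hf.2.2.2.2.1 hf.2.2.2.2.2.2.2.1
    he.2.2.2.2.2 hf.2.2.2.2.2.1 hf.2.2.2.2.2.2.2.2.1 hf.2.2.2.2.2.2.2.2.2

variable [DecidableEq α]

/-- Distinct lines share at most one point. Iterated, this finds points of a large line that avoid
several other lines. -/
theorem card_le_card_sdiff (h : LinearSpace S ln) {L L' A : Finset α} (hL : IsLine S ln L)
    (hL' : IsLine S ln L') (hne : L ≠ L') (hA : A ⊆ L) : #A ≤ #(A \ L') + 1 := by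
  have h1 : #(A ∩ L') ≤ 1 := by
    refine card_le_one.2 fun u hu v hv => by_contra fun huv => hne ?_
    rw [mem_inter] at hu hv
    exact h.lines_eq hL hL' (hA hu.1) (hA hv.1) hu.2 hv.2 huv
  have := card_sdiff_add_card_inter A L'
  omega

theorem mem_longLines {L : Finset α} :
    L ∈ longLines S ln ↔ IsLine S ln L ∧ 3 ≤ #L := by
  simp only [longLines, mem_filter, mem_image, mem_offDiag, Prod.exists, IsLine]
  constructor
  · rintro ⟨⟨x, y, ⟨hx, hy, hxy⟩, h1⟩, h2⟩
    exact ⟨⟨x, hx, y, hy, hxy, h1⟩, h2⟩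
  · rintro ⟨⟨x, hx, y, hy, hxy, h1⟩, h2⟩
    exact ⟨⟨x, y, ⟨hx, hy, hxy⟩, h1⟩, h2⟩

/-- A line through `q` is determined by any second point on it, so each `q ∈ Q` accounts for at most
`#S` lines. -/
theorem card_longLines_le (h : LinearSpace S ln) (Q : Finset α) (E : Finset (Finset α))
    (hE : ∀ L ∈ longLines S ln, L ∈ E ∨ ∃ q ∈ Q, q ∈ L) :
    #(longLines S ln) ≤ #E + #Q * #S := by
  have hsub : longLines S ln ⊆ E ∪ image₂ ln Q S := by
    intro L hL
    rcases hE L hL with hL' | ⟨q, hq, hqL⟩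
    · exact mem_union_left _ hL'
    · rw [mem_longLines] at hL
      obtain ⟨y, hy, hyq⟩ := exists_mem_ne (show 1 < #L by omega) q
      exact mem_union_right _
        (mem_image₂.2 ⟨q, hq, y, h.line_subset hL.1 hy, h.line_eq hL.1 hqL hy hyq.symm⟩)
  exact (card_le_card hsub).trans ((card_union_le _ _).trans
    (Nat.add_le_add_left (card_image₂_le _ _ _) _))

theorem card_longLines_le_sq (h : LinearSpace S ln) : #(longLines S ln) ≤ #S * #S := by
  have := h.card_longLines_le S ∅ fun L hL => by
    rw [mem_longLines] at hL
    obtain ⟨x, hx⟩ := card_pos.1 (show 0 < #L by omega)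
    exact Or.inr ⟨x, h.line_subset hL.1 hx, hx⟩
  simpa using this

theorem exists_avoid (l : List (Finset α)) (m : ℕ) (hl : ∀ L ∈ l, #L ≤ m)
    (hS : l.length * m < #S) : ∃ x ∈ S, ∀ L ∈ l, x ∉ L := by
  have h1 : #(l.toFinset.biUnion id) < #S := by
    refine lt_of_le_of_lt (card_biUnion_le_card_mul _ _ m fun L hL => hl L (by simpa using hL)) ?_
    exact lt_of_le_of_lt (Nat.mul_le_mul_right _ (List.toFinset_card_le l)) hS
  obtain ⟨x, hx, hx'⟩ := exists_mem_notMem_of_card_lt_card h1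
  refine ⟨x, hx, fun L hL hxL => hx' (mem_biUnion.2 ⟨L, by simpa using hL, hxL⟩)⟩

theorem card_line_le {m : ℕ} (hm : 2 ≤ m)
    (hlong : ∀ L ∈ longLines S ln, #L ≤ m) {L : Finset α} (hL : IsLine S ln L) : #L ≤ m := by
  by_cases h3 : 3 ≤ #L
  · exact hlong L (mem_longLines.2 ⟨hL, h3⟩)
  · omega

theorem card_le_two_of_forall_ne {β : Type*} [DecidableEq β] {X : Finset β} (L : β)
    (hX : ∀ L₁ ∈ X, ∀ L₂ ∈ X, L₁ ≠ L → L₂ ≠ L → L₁ = L₂) : #X ≤ 2 := by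
  have h1 : #(X.erase L) ≤ 1 := card_le_one.2 fun a ha b hb => by
    rw [mem_erase] at ha hb
    exact hX a ha.2 b hb.2 ha.1 hb.1
  have := pred_card_le_card_erase (s := X) (a := L)
  omega

theorem card_longLines_le_of_card_le_two (h : LinearSpace S ln) (h2 : #(longLines S ln) ≤ 2) :
    #(longLines S ln) ≤ 100 * #S := by
  rcases (longLines S ln).eq_empty_or_nonempty with h0 | ⟨L, hL⟩
  · simp [h0]
  · rw [mem_longLines] at hL
    have := card_le_card (h.line_subset hL.1)
    omega

/-- The constant 100 leaves room for the greedy constructions in larger spaces, which avoid at most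
ten lines of at most seven points. -/
theorem card_longLines_le_of_card_le (h : LinearSpace S ln) (hS : #S ≤ 100) :
    #(longLines S ln) ≤ 100 * #S :=
  h.card_longLines_le_sq.trans (Nat.mul_le_mul_right _ hS)

theorem hasConfig_R6 (h : LinearSpace S ln) {L L' : Finset α} (hL : IsLine S ln L)
    (hL' : IsLine S ln L') (h1 : 3 ≤ #(L \ L')) (h2 : 3 ≤ #(L' \ L)) :
    HasConfig S ln {{0, 1, 2}, {3, 4, 5}} := by
  obtain ⟨a, ha, b, hb, c, hc, hab, hac, hbc⟩ := two_lt_card.1 h1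
  obtain ⟨d, hd, e, he, f, hf, hde, hdf, hef⟩ := two_lt_card.1 h2
  rw [mem_sdiff] at ha hb hc hd he hf
  have hLS := h.line_subset hL
  have hLS' := h.line_subset hL'
  refine ⟨![a, b, c, d, e, f], injective_six (by simp; grind),
    forall_six (hLS ha.1) (hLS hb.1) (hLS hc.1) (hLS' hd.1) (hLS' he.1) (hLS' hf.1),
    forall_triples (iff_of_true (h.line_eq hL ha.1 hb.1 hab ▸ hc.1) (by decide))
    (iff_of_false (h.notMem_right hL ha.1 hb.1 hab hd.2) (by decide))
    (iff_of_false (h.notMem_right hL ha.1 hb.1 hab he.2) (by decide))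
    (iff_of_false (h.notMem_right hL ha.1 hb.1 hab hf.2) (by decide))
    (iff_of_false (h.notMem_right hL ha.1 hc.1 hac hd.2) (by decide))
    (iff_of_false (h.notMem_right hL ha.1 hc.1 hac he.2) (by decide))
    (iff_of_false (h.notMem_right hL ha.1 hc.1 hac hf.2) (by decide))
    (iff_of_false (h.notMem_left hL' hd.1 he.1 hde ha.2 (hLS ha.1)) (by decide))
    (iff_of_false (h.notMem_left hL' hd.1 hf.1 hdf ha.2 (hLS ha.1)) (by decide))
    (iff_of_false (h.notMem_left hL' he.1 hf.1 hef ha.2 (hLS ha.1)) (by decide))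
    (iff_of_false (h.notMem_right hL hb.1 hc.1 hbc hd.2) (by decide))
    (iff_of_false (h.notMem_right hL hb.1 hc.1 hbc he.2) (by decide))
    (iff_of_false (h.notMem_right hL hb.1 hc.1 hbc hf.2) (by decide))
    (iff_of_false (h.notMem_left hL' hd.1 he.1 hde hb.2 (hLS hb.1)) (by decide))
    (iff_of_false (h.notMem_left hL' hd.1 hf.1 hdf hb.2 (hLS hb.1)) (by decide))
    (iff_of_false (h.notMem_left hL' he.1 hf.1 hef hb.2 (hLS hb.1)) (by decide))
    (iff_of_false (h.notMem_left hL' hd.1 he.1 hde hc.2 (hLS hc.1)) (by decide))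
    (iff_of_false (h.notMem_left hL' hd.1 hf.1 hdf hc.2 (hLS hc.1)) (by decide))
    (iff_of_false (h.notMem_left hL' he.1 hf.1 hef hc.2 (hLS hc.1)) (by decide))
    (iff_of_true (h.line_eq hL' hd.1 he.1 hde ▸ hf.1) (by decide))⟩

/-! ### Few long lines when `R6`, `P6`, `Q6` or `U_{3,6}` is excluded. -/

/-- Disjoint long lines would give the configuration, so all long lines meet. If one has exactly
three points, every long line passes through one of these; if none has, two long lines would each
have three points off the other. -/
theorem card_longLines_le_of_not_hasConfig_R6 (h : LinearSpace S ln)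
    (hC : ¬ HasConfig S ln {{0, 1, 2}, {3, 4, 5}}) : #(longLines S ln) ≤ 100 * #S := by
  have hmeet : ∀ L ∈ longLines S ln, ∀ L' ∈ longLines S ln, ∃ q ∈ L, q ∈ L' := by
    intro L hL L' hL'
    rw [mem_longLines] at hL hL'
    by_contra! hdisj
    have hd : Disjoint L L' := disjoint_left.2 hdisj
    refine hC (h.hasConfig_R6 hL.1 hL'.1 ?_ ?_)
    · rw [sdiff_eq_self_of_disjoint hd]; exact hL.2
    · rw [sdiff_eq_self_of_disjoint hd.symm]; exact hL'.2
  by_cases h3 : ∃ L ∈ longLines S ln, #L = 3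
  · obtain ⟨L, hL, hL3⟩ := h3
    have := h.card_longLines_le L ∅ fun L' hL' => Or.inr (hmeet L hL L' hL')
    rw [hL3] at this
    simp only [card_empty] at this
    omega
  · push Not at h3
    refine h.card_longLines_le_of_card_le_two (le_trans (card_le_one.2 ?_) (by norm_num))
    intro L hL L' hL'
    have h4 := h3 L hL
    have h4' := h3 L' hL'
    rw [mem_longLines] at hL hL'
    by_contra hne
    have h5 := h.card_le_card_sdiff hL.1 hL'.1 hne Subset.rfl
    have h6 := h.card_le_card_sdiff hL'.1 hL.1 (Ne.symm hne) Subset.rfl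
    exact hC (h.hasConfig_R6 hL.1 hL'.1 (by omega) (by omega))

/-- A line with six points allows only one other long line, since two others supply a triangle off
it. If all lines have at most five points, a collinear triple extends greedily unless `S` is small.
-/
theorem card_longLines_le_of_not_hasConfig_P6 (h : LinearSpace S ln)
    (hC : ¬ HasConfig S ln {{0, 1, 2}}) : #(longLines S ln) ≤ 100 * #S := by
  by_cases hbig : ∃ L ∈ longLines S ln, 6 ≤ #L
  · obtain ⟨L, hL, hL6⟩ := hbig
    refine h.card_longLines_le_of_card_le_two (card_le_two_of_forall_ne L ?_)
    intro L' hL' L'' hL'' hne' hne''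
    rw [mem_longLines] at hL hL' hL''
    have hLS := h.line_subset hL.1
    by_contra hne
    have h1 := h.card_le_card_sdiff hL'.1 hL.1 hne' Subset.rfl
    have h2 := h.card_le_card_sdiff hL''.1 hL.1 hne'' Subset.rfl
    have h3 := h.card_le_card_sdiff hL''.1 hL'.1 (Ne.symm hne) (A := L'' \ L) sdiff_subset
    obtain ⟨d, hd, e, he, hde⟩ := one_lt_card.1 (show 1 < #(L' \ L) by omega)
    obtain ⟨f, hf⟩ := card_pos.1 (show 0 < #((L'' \ L) \ L') by omega)
    simp only [mem_sdiff] at hd he hf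
    have hdS := h.line_subset hL'.1 hd.1
    have heS := h.line_subset hL'.1 he.1
    have hfS := h.line_subset hL''.1 hf.1.1
    have hdf : d ≠ f := fun e => hf.2 (e ▸ hd.1)
    have hef : e ≠ f := fun e => hf.2 (e ▸ he.1)
    have hln : ∀ {x y}, x ∈ S → y ∈ S → x ∉ L → x ≠ y → L ≠ ln x y :=
      fun hx hy hxL hxy e => hxL (e ▸ h.left hx hy hxy)
    -- The three sides of the triangle `d`, `e`, `f` each remove at most one point of `L`, so three
    -- of six remain.
    have h4 := h.card_le_card_sdiff hL.1 (isLine hdS heS hde) (hln hdS heS hd.2 hde) Subset.rfl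
    have h5 := h.card_le_card_sdiff hL.1 (isLine hdS hfS hdf) (hln hdS hfS hd.2 hdf)
      (A := L \ ln d e) sdiff_subset
    have h6 := h.card_le_card_sdiff hL.1 (isLine heS hfS hef) (hln heS hfS he.2 hef)
      (A := (L \ ln d e) \ ln d f) (sdiff_subset.trans sdiff_subset)
    obtain ⟨a, ha, b, hb, c, hc, hab, hac, hbc⟩ :=
      two_lt_card.1 (show 2 < #(((L \ ln d e) \ ln d f) \ ln e f) by omega)
    simp only [mem_sdiff, and_assoc] at ha hb hc
    have key : ∀ x, x ∈ L ∧ x ∉ ln d e ∧ x ∉ ln d f ∧ x ∉ ln e f →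
        e ∉ ln x d ∧ f ∉ ln x d ∧ f ∉ ln x e := fun x ⟨hxL, hde', hdf', hef'⟩ =>
      ⟨h.notMem_left (isLine hdS heS hde) (h.left hdS heS hde) (h.right hdS heS hde) hde hde'
        (hLS hxL),
      h.notMem_left (isLine hdS hfS hdf) (h.left hdS hfS hdf) (h.right hdS hfS hdf) hdf hdf'
        (hLS hxL),
      h.notMem_left (isLine heS hfS hef) (h.left heS hfS hef) (h.right heS hfS hef) hef hef'
        (hLS hxL)⟩
    refine hC (hasConfig_P6 ⟨hLS ha.1, hLS hb.1, hLS hc.1, hdS, heS, hfS⟩ (by simp; grind)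
      (h.line_eq hL.1 ha.1 hb.1 hab ▸ hc.1) ?_ ?_ ?_ (key a ha) (key b hb) (key c hc)
      (h.notMem_right hL'.1 hd.1 he.1 hde hf.2))
    · rw [h.line_eq hL.1 ha.1 hb.1 hab]; exact ⟨hd.2, he.2, hf.1.2⟩
    · rw [h.line_eq hL.1 ha.1 hc.1 hac]; exact ⟨hd.2, he.2, hf.1.2⟩
    · rw [h.line_eq hL.1 hb.1 hc.1 hbc]; exact ⟨hd.2, he.2, hf.1.2⟩
  · push Not at hbig
    rcases (longLines S ln).eq_empty_or_nonempty with h0 | ⟨L, hL⟩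
    · simp [h0]
    refine h.card_longLines_le_of_card_le ?_
    by_contra! hS
    have h5 : ∀ {x y}, x ∈ S → y ∈ S → x ≠ y → #(ln x y) ≤ 5 := fun hx hy hxy =>
      card_line_le (by norm_num) (fun L hL => Nat.le_of_lt_succ (hbig L hL)) (isLine hx hy hxy)
    have hL5 := hbig L hL
    rw [mem_longLines] at hL
    have hLS := h.line_subset hL.1
    obtain ⟨a, ha, b, hb, c, hc, hab, hac, hbc⟩ := two_lt_card.1 hL.2
    have hab' := h.line_eq hL.1 ha hb hab
    have hac' := h.line_eq hL.1 ha hc hac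
    have hbc' := h.line_eq hL.1 hb hc hbc
    obtain ⟨d, hd, hdL⟩ := exists_avoid (S := S) [L] 5 (by simp; omega) (by simp; omega)
    simp only [List.mem_singleton, forall_eq] at hdL
    have had : a ≠ d := fun e => hdL (e ▸ ha)
    have hbd : b ≠ d := fun e => hdL (e ▸ hb)
    have hcd : c ≠ d := fun e => hdL (e ▸ hc)
    have had5 := h5 (hLS ha) hd had
    have hbd5 := h5 (hLS hb) hd hbd
    have hcd5 := h5 (hLS hc) hd hcd
    obtain ⟨e, he, heL⟩ := exists_avoid (S := S) [L, ln a d, ln b d, ln c d] 5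
      (by simp; omega) (by simp; omega)
    simp only [List.mem_cons, List.not_mem_nil, or_false, forall_eq_or_imp, forall_eq] at heL
    obtain ⟨heL, head, hebd, hecd⟩ := heL
    have hae : a ≠ e := fun e => heL (e ▸ ha)
    have hbe : b ≠ e := fun e => heL (e ▸ hb)
    have hce : c ≠ e := fun e => heL (e ▸ hc)
    have hde : d ≠ e := fun e => head (e ▸ h.right (hLS ha) hd had)
    have hae5 := h5 (hLS ha) he hae
    have hbe5 := h5 (hLS hb) he hbe
    have hce5 := h5 (hLS hc) he hce
    have hde5 := h5 hd he hde
    obtain ⟨f, hf, hfL⟩ := exists_avoid (S := S)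
      [L, ln a d, ln b d, ln c d, ln a e, ln b e, ln c e, ln d e] 5 (by simp; omega) (by simp; omega)
    simp only [List.mem_cons, List.not_mem_nil, or_false, forall_eq_or_imp, forall_eq] at hfL
    obtain ⟨hfL, hfad, hfbd, hfcd, hfae, hfbe, hfce, hfde⟩ := hfL
    have hdf : d ≠ f := fun e' => hfde (e' ▸ h.left hd he hde)
    have hef : e ≠ f := fun e' => hfde (e' ▸ h.right hd he hde)
    refine hC (hasConfig_P6 ⟨hLS ha, hLS hb, hLS hc, hd, he, hf⟩ ?_ (hab' ▸ hc)
      (hab' ▸ ⟨hdL, heL, hfL⟩) (hac' ▸ ⟨hdL, heL, hfL⟩) (hbc' ▸ ⟨hdL, heL, hfL⟩)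
      ⟨head, hfad, hfae⟩ ⟨hebd, hfbd, hfbe⟩ ⟨hecd, hfcd, hfce⟩ hfde)
    have haf : a ≠ f := fun e => hfL (e ▸ ha)
    have hbf : b ≠ f := fun e => hfL (e ▸ hb)
    have hcf : c ≠ f := fun e => hfL (e ▸ hc)
    simp [*]

theorem notMem_of_mem_erase (h : LinearSpace S ln) {L L' : Finset α} (hL : IsLine S ln L)
    (hL' : IsLine S ln L') (hne : L ≠ L') {p x : α} (hp : p ∈ L) (hp' : p ∈ L')
    (hx : x ∈ L.erase p) : p ≠ x ∧ x ∈ L ∧ x ∉ L' := by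
  rw [mem_erase] at hx
  exact ⟨hx.1.symm, hx.2, fun hx' => hne (h.lines_eq hL hL' hp hx.2 hp' hx' hx.1.symm)⟩

/-- Given `e` off both lines, pick `c`, `d` on `L'` besides `p`. The lines `ce` and `de` remove at
most two of the four other points of `L`, leaving `a`, `b` to complete the configuration. -/
theorem mem_union_of_not_hasConfig_Q6 (h : LinearSpace S ln)
    (hC : ¬ HasConfig S ln {{0, 1, 2}, {0, 3, 4}}) {L L' : Finset α} (hL : IsLine S ln L)
    (hL5 : 5 ≤ #L) (hL' : IsLine S ln L') (hL3 : 3 ≤ #L') (hne : L ≠ L') {p : α} (hp : p ∈ L)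
    (hp' : p ∈ L') {e : α} (he : e ∈ S) : e ∈ L ∨ e ∈ L' := by
  by_contra! hcon
  have hcard := card_erase_of_mem hp
  have hcard' := card_erase_of_mem hp'
  obtain ⟨c, hc, d, hd, hcd⟩ := one_lt_card.1 (show 1 < #(L'.erase p) by omega)
  obtain ⟨hpc, hcL', hcL⟩ := h.notMem_of_mem_erase hL' hL hne.symm hp' hp hc
  obtain ⟨hpd, hdL', hdL⟩ := h.notMem_of_mem_erase hL' hL hne.symm hp' hp hd
  have hcS := h.line_subset hL' hcL'
  have hdS := h.line_subset hL' hdL'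
  have hce : c ≠ e := fun e => hcon.2 (e ▸ hcL')
  have hde : d ≠ e := fun e => hcon.2 (e ▸ hdL')
  have hlc := isLine (ln := ln) hcS he hce
  have hld := isLine (ln := ln) hdS he hde
  have h1 := h.card_le_card_sdiff hL hlc (fun e => hcL (e ▸ h.left hcS he hce)) (erase_subset p L)
  have h2 := h.card_le_card_sdiff hL hld (fun e => hdL (e ▸ h.left hdS he hde))
    (A := L.erase p \ ln c e) (sdiff_subset.trans (erase_subset p L))
  obtain ⟨a, ha, b, hb, hab⟩ := one_lt_card.1 (show 1 < #((L.erase p \ ln c e) \ ln d e) by omega)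
  simp only [mem_sdiff, and_assoc] at ha hb
  obtain ⟨hpa, haL, haL'⟩ := h.notMem_of_mem_erase hL hL' hne hp hp' ha.1
  obtain ⟨hpb, hbL, hbL'⟩ := h.notMem_of_mem_erase hL hL' hne hp hp' hb.1
  have key : ∀ {x y}, x ∈ S → y ∈ S → y ≠ e → x ∉ ln y e → e ∉ ln x y := fun hx hy hye hxy =>
    h.notMem_left (isLine hy he hye) (h.left hy he hye) (h.right hy he hye) hye hxy hx
  have haS := h.line_subset hL haL
  have hbS := h.line_subset hL hbL
  exact hC (h.hasConfig_Q6 hL hL' hp hp' haL hbL hcL' hdL' he hpa hpb hab hpc hpd hcd haL' hbL'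
    hcL hdL hcon.1 hcon.2 (key haS hcS hce ha.2.1) (key haS hdS hde ha.2.2)
    (key hbS hcS hce hb.2.1) (key hbS hdS hde hb.2.2))

/-- If meeting long lines `L`, `L'` with `5 ≤ #L` exist, they cover `S`, which rules out a third
long line. If meeting long lines all have at most four points, so do the lines to be avoided, and a
sixth point exists in a large space. Pairwise disjoint long lines number at most `#S / 3`. -/
theorem card_longLines_le_of_not_hasConfig_Q6 (h : LinearSpace S ln)
    (hC : ¬ HasConfig S ln {{0, 1, 2}, {0, 3, 4}}) : #(longLines S ln) ≤ 100 * #S := by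
  by_cases hmeet : ∃ L ∈ longLines S ln, ∃ L' ∈ longLines S ln, L ≠ L' ∧ ∃ p ∈ L, p ∈ L'
  · by_cases hbig : ∃ L ∈ longLines S ln, ∃ L' ∈ longLines S ln, L ≠ L' ∧ (∃ p ∈ L, p ∈ L') ∧
        5 ≤ #L
    · obtain ⟨L, hL, L', hL', hne, ⟨p, hp, hp'⟩, hL5⟩ := hbig
      rw [mem_longLines] at hL hL'
      refine h.card_longLines_le_of_card_le_two (card_le_two_of_forall_ne L ?_)
      have key : ∀ M ∈ longLines S ln, M ≠ L → M = L' := by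
        intro M hM hML
        rw [mem_longLines] at hM
        by_contra hML'
        have h1 := h.card_le_card_sdiff hM.1 hL.1 hML Subset.rfl
        have h2 := h.card_le_card_sdiff hM.1 hL'.1 hML' (A := M \ L) sdiff_subset
        obtain ⟨x, hx⟩ := card_pos.1 (show 0 < #((M \ L) \ L') by omega)
        simp only [mem_sdiff] at hx
        rcases h.mem_union_of_not_hasConfig_Q6 hC hL.1 hL5 hL'.1 hL'.2 hne hp hp'
          (h.line_subset hM.1 hx.1.1) with hx' | hx'
        · exact hx.1.2 hx'
        · exact hx.2 hx'
      exact fun M₁ h1 M₂ h2 hn1 hn2 => (key M₁ h1 hn1).trans (key M₂ h2 hn2).symm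
    · push Not at hbig
      obtain ⟨L, hL, L', hL', hne, p, hp, hp'⟩ := hmeet
      have hL4 := hbig L hL L' hL' hne ⟨p, hp, hp'⟩
      have hL4' := hbig L' hL' L hL hne.symm ⟨p, hp', hp⟩
      have hsz : ∀ {x y}, x ∈ L → y ∈ S → y ∉ L → #(ln x y) ≤ 4 := by
        intro x y hx hy hyL
        have hxS := h.line_subset (mem_longLines.1 hL).1 hx
        have hxy : x ≠ y := fun e => hyL (e ▸ hx)
        by_cases h3 : 3 ≤ #(ln x y)
        · exact Nat.le_of_lt_succ (hbig _ (mem_longLines.2 ⟨isLine hxS hy hxy, h3⟩) L hL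
            (fun e => hyL (e ▸ h.right hxS hy hxy)) ⟨x, h.left hxS hy hxy, hx⟩)
        · omega
      refine h.card_longLines_le_of_card_le ?_
      by_contra! hS
      rw [mem_longLines] at hL hL'
      have hcard := card_erase_of_mem hp
      have hcard' := card_erase_of_mem hp'
      obtain ⟨c, hc, d, hd, hcd⟩ := one_lt_card.1 (show 1 < #(L'.erase p) by omega)
      obtain ⟨a, ha, b, hb, hab⟩ := one_lt_card.1 (show 1 < #(L.erase p) by omega)
      obtain ⟨hpc, hcL', hcL⟩ := h.notMem_of_mem_erase hL'.1 hL.1 hne.symm hp' hp hc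
      obtain ⟨hpd, hdL', hdL⟩ := h.notMem_of_mem_erase hL'.1 hL.1 hne.symm hp' hp hd
      obtain ⟨hpa, haL, haL'⟩ := h.notMem_of_mem_erase hL.1 hL'.1 hne hp hp' ha
      obtain ⟨hpb, hbL, hbL'⟩ := h.notMem_of_mem_erase hL.1 hL'.1 hne hp hp' hb
      have hcS := h.line_subset hL'.1 hcL'
      have hdS := h.line_subset hL'.1 hdL'
      have h1 := hsz haL hcS hcL
      have h2 := hsz haL hdS hdL
      have h3 := hsz hbL hcS hcL
      have h4 := hsz hbL hdS hdL
      obtain ⟨e, he, hav⟩ := exists_avoid (S := S) [L, L', ln a c, ln a d, ln b c, ln b d] 4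
        (by simp; omega) (by simp; omega)
      simp only [List.mem_cons, List.not_mem_nil, or_false, forall_eq_or_imp, forall_eq] at hav
      exact hC (h.hasConfig_Q6 hL.1 hL'.1 hp hp' haL hbL hcL' hdL' he hpa hpb hab hpc hpd hcd haL'
        hbL' hcL hdL hav.1 hav.2.1 hav.2.2.1 hav.2.2.2.1 hav.2.2.2.2.1 hav.2.2.2.2.2)
  · push Not at hmeet
    have hdisj : ((longLines S ln : Finset (Finset α)) : Set (Finset α)).PairwiseDisjoint id :=
      fun L hL L' hL' hne => disjoint_left.2 (hmeet L hL L' hL' hne)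
    have h1 := card_biUnion hdisj
    have h2 : #((longLines S ln).biUnion id) ≤ #S :=
      card_le_card (biUnion_subset.2 fun L hL => h.line_subset (mem_longLines.1 hL).1)
    have h3 : #(longLines S ln) • 3 ≤ ∑ L ∈ longLines S ln, #(id L) :=
      card_nsmul_le_sum _ _ _ fun L hL => (mem_longLines.1 hL).2
    rw [smul_eq_mul] at h3
    omega

/-- If there is a line with at least eight points and no six points in general position, then
there are no four points in general position off this line. -/
theorem not_general_position_off_line (h : LinearSpace S ln) (hC : ¬ HasConfig S ln ∅)
    {L : Finset α} (hL : IsLine S ln L) (hL8 : 8 ≤ #L) {w x y z : α}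
    (hS : w ∈ S ∧ x ∈ S ∧ y ∈ S ∧ z ∈ S) (hw : w ∉ L) (hx : x ∉ L) (hy : y ∉ L) (hz : z ∉ L)
    (hwx : w ≠ x) (hwxy : y ∉ ln w x) : ¬ (z ∉ ln w x ∧ z ∉ ln w y ∧ z ∉ ln x y) := by
  rintro ⟨hwxz, hwyz, hxyz⟩
  obtain ⟨hwS, hxS, hyS, hzS⟩ := hS
  have hwy : w ≠ y := fun e => hwxy (e ▸ h.left hwS hxS hwx)
  have hxy : x ≠ y := fun e => hwxy (e ▸ h.right hwS hxS hwx)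
  have hwz : w ≠ z := fun e => hwxz (e ▸ h.left hwS hxS hwx)
  have hxz : x ≠ z := fun e => hwxz (e ▸ h.right hwS hxS hwx)
  have hyz : y ≠ z := fun e => hwyz (e ▸ h.right hwS hyS hwy)
  have key : ∀ {u v A}, u ∈ S → v ∈ S → u ≠ v → u ∉ L → A ⊆ L →
      A \ ln u v ⊆ L ∧ #A ≤ #(A \ ln u v) + 1 := fun hu hv huv huL hA =>
    ⟨sdiff_subset.trans hA, h.card_le_card_sdiff hL (isLine hu hv huv)
      (fun e => huL (e ▸ h.left hu hv huv)) hA⟩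
  have k1 := key hwS hxS hwx hw (Subset.refl L)
  have k2 := key hwS hyS hwy hw k1.1
  have k3 := key hxS hyS hxy hx k2.1
  have k4 := key hwS hzS hwz hw k3.1
  have k5 := key hxS hzS hxz hx k4.1
  have k6 := key hyS hzS hyz hy k5.1
  -- The six lines spanned by the four points each remove at most one of the eight points of `L`.
  obtain ⟨a, ha, b, hb, hab⟩ := one_lt_card.1 (show 1 < #((((((L \ ln w x) \ ln w y) \ ln x y) \
    ln w z) \ ln x z) \ ln y z) by omega)
  have haL := k6.1 ha
  have hbL := k6.1 hb
  simp only [mem_sdiff, and_assoc] at ha hb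
  have hLS := h.line_subset hL
  exact hC (h.hasConfig_U36 ⟨hwS, hxS, hyS, hzS, hLS haL, hLS hbL⟩ hwx hwxy ⟨hwxz, hwyz, hxyz⟩
    ha.2 ⟨hb.2.1, hb.2.2.1, hb.2.2.2.1, hb.2.2.2.2.1, hb.2.2.2.2.2.1, hb.2.2.2.2.2.2,
      h.notMem_left hL haL hbL hab hw hwS, h.notMem_left hL haL hbL hab hx hxS,
      h.notMem_left hL haL hbL hab hy hyS, h.notMem_left hL haL hbL hab hz hzS⟩)

theorem hasConfig_U36_of_card_line_le (h : LinearSpace S ln) (hS : 100 < #S)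
    (h7 : ∀ {x y}, x ∈ S → y ∈ S → x ≠ y → #(ln x y) ≤ 7) : HasConfig S ln ∅ := by
  have key : ∀ {x y z}, x ∈ S → y ∈ S → x ≠ y → z ∉ ln x y → x ≠ z ∧ y ≠ z :=
    fun hx hy hxy hz => ⟨fun e => hz (e ▸ h.left hx hy hxy), fun e => hz (e ▸ h.right hx hy hxy)⟩
  obtain ⟨a, ha, b, hb, hab⟩ := one_lt_card.1 (show 1 < #S by omega)
  have l1 := h7 ha hb hab
  obtain ⟨c, hc, hc'⟩ := exists_avoid (S := S) [ln a b] 7 (by simp; omega) (by simp; omega)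
  simp only [List.mem_singleton, forall_eq] at hc'
  have hac := key ha hb hab hc'
  have l2 := h7 ha hc hac.1
  have l3 := h7 hb hc hac.2
  obtain ⟨d, hd, hd'⟩ := exists_avoid (S := S) [ln a b, ln a c, ln b c] 7
    (by simp; omega) (by simp; omega)
  simp only [List.mem_cons, List.not_mem_nil, or_false, forall_eq_or_imp, forall_eq] at hd'
  have had := key ha hb hab hd'.1
  have hcd := key ha hc hac.1 hd'.2.1
  have l4 := h7 ha hd had.1
  have l5 := h7 hb hd had.2
  have l6 := h7 hc hd hcd.2
  obtain ⟨e, he, he'⟩ := exists_avoid (S := S)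
    [ln a b, ln a c, ln b c, ln a d, ln b d, ln c d] 7 (by simp; omega) (by simp; omega)
  simp only [List.mem_cons, List.not_mem_nil, or_false, forall_eq_or_imp, forall_eq] at he'
  have hae := key ha hb hab he'.1
  have hce := key hc hd hcd.2 he'.2.2.2.2.2
  have l7 := h7 ha he hae.1
  have l8 := h7 hb he hae.2
  have l9 := h7 hc he hce.1
  have l10 := h7 hd he hce.2
  obtain ⟨f, hf, hf'⟩ := exists_avoid (S := S)
    [ln a b, ln a c, ln b c, ln a d, ln b d, ln c d, ln a e, ln b e, ln c e, ln d e] 7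
    (by simp; omega) (by simp; omega)
  simp only [List.mem_cons, List.not_mem_nil, or_false, forall_eq_or_imp, forall_eq] at hf'
  exact h.hasConfig_U36 ⟨ha, hb, hc, hd, he, hf⟩ hab hc' hd' he' hf'

/-- Suppose `L` has eight points. If another line `L'` has three points off `L`, two points off `L ∪
L'` together with two suitable points of `L'` would be in general position; so all further long
lines share one point. If no such `L'` exists, no three points off `L` are collinear, so at most
three points lie off `L`. Without a large `L`, six points are found greedily. -/
theorem card_longLines_le_of_not_hasConfig_U36 (h : LinearSpace S ln)
    (hC : ¬ HasConfig S ln ∅) : #(longLines S ln) ≤ 100 * #S := by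
  by_cases hbig : ∃ L ∈ longLines S ln, 8 ≤ #L
  · obtain ⟨L, hL, hL8⟩ := hbig
    rw [mem_longLines] at hL
    have hSpos := card_le_card (h.line_subset hL.1)
    by_cases h2 : ∃ L', IsLine S ln L' ∧ L' ≠ L ∧ 3 ≤ #(L' \ L)
    · obtain ⟨L', hL', hne, hL3⟩ := h2
      have hQ : #{q ∈ S | q ∉ L ∧ q ∉ L'} ≤ 1 := by
        refine card_le_one.2 fun u hu v hv => by_contra fun huv => ?_
        rw [mem_filter] at hu hv
        have hluv := isLine (ln := ln) hu.1 hv.1 huv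
        have h1 := h.card_le_card_sdiff hL' hluv (fun e => hu.2.2 (e ▸ h.left hu.1 hv.1 huv))
          (A := L' \ L) sdiff_subset
        obtain ⟨w, hw, x, hx, hwx⟩ := one_lt_card.1 (show 1 < #((L' \ L) \ ln u v) by omega)
        simp only [mem_sdiff, and_assoc] at hw hx
        have hwS := h.line_subset hL' hw.1
        have hxS := h.line_subset hL' hx.1
        have hu' := h.left hu.1 hv.1 huv
        have hv' := h.right hu.1 hv.1 huv
        exact h.not_general_position_off_line hC hL.1 hL8 ⟨hwS, hxS, hu.1, hv.1⟩ hw.2.1 hx.2.1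
          hu.2.1 hv.2.1 hwx (h.notMem_right hL' hw.1 hx.1 hwx hu.2.2)
          ⟨h.notMem_right hL' hw.1 hx.1 hwx hv.2.2, h.notMem_left hluv hu' hv' huv hw.2.2 hwS,
            h.notMem_left hluv hu' hv' huv hx.2.2 hxS⟩
      have hle := h.card_longLines_le {q ∈ S | q ∉ L ∧ q ∉ L'} {L, L'} fun M hM => by
        by_contra! hcon
        rw [mem_longLines] at hM
        simp only [mem_insert, mem_singleton, not_or] at hcon
        have h1 := h.card_le_card_sdiff hM.1 hL.1 hcon.1.1 Subset.rfl
        have h2 := h.card_le_card_sdiff hM.1 hL' hcon.1.2 (A := M \ L) sdiff_subset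
        obtain ⟨x, hx⟩ := card_pos.1 (show 0 < #((M \ L) \ L') by omega)
        simp only [mem_sdiff, and_assoc] at hx
        exact hcon.2 x (mem_filter.2 ⟨h.line_subset hM.1 hx.1, hx.2⟩) hx.1
      have h3 := Nat.mul_le_mul_right #S hQ
      have h4 := card_le_two (a := L) (b := L')
      omega
    · push Not at h2
      have hgen : ∀ {w x y}, w ∈ S \ L → x ∈ S \ L → y ∈ S \ L → w ≠ x → w ≠ y → x ≠ y →
          y ∉ ln w x := by
        intro w x y hw hx hy hwx hwy hxy hmem
        rw [mem_sdiff] at hw hx hy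
        have hw' := h.left hw.1 hx.1 hwx
        have hx' := h.right hw.1 hx.1 hwx
        have hlt := h2 _ (isLine hw.1 hx.1 hwx) fun e => hw.2 (e ▸ hw')
        have hgt := two_lt_card.2 ⟨w, mem_sdiff.2 ⟨hw', hw.2⟩, x, mem_sdiff.2 ⟨hx', hx.2⟩, y,
          mem_sdiff.2 ⟨hmem, hy.2⟩, hwx, hwy, hxy⟩
        omega
      have hQ : #(S \ L) ≤ 3 := by
        by_contra! hQ
        obtain ⟨z, hz⟩ := card_pos.1 (show 0 < #(S \ L) by omega)
        have := card_erase_of_mem hz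
        obtain ⟨w, hw, x, hx, y, hy, hwx, hwy, hxy⟩ :=
          two_lt_card.1 (show 2 < #((S \ L).erase z) by omega)
        rw [mem_erase] at hw hx hy
        have hS : ∀ {u}, u ∈ S \ L → u ∈ S := fun hu => (mem_sdiff.1 hu).1
        have hnL : ∀ {u}, u ∈ S \ L → u ∉ L := fun hu => (mem_sdiff.1 hu).2
        exact h.not_general_position_off_line hC hL.1 hL8 ⟨hS hw.2, hS hx.2, hS hy.2, hS hz⟩
          (hnL hw.2) (hnL hx.2) (hnL hy.2) (hnL hz) hwx (hgen hw.2 hx.2 hy.2 hwx hwy hxy)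
          ⟨hgen hw.2 hx.2 hz hwx hw.1 hx.1, hgen hw.2 hy.2 hz hwy hw.1 hy.1,
            hgen hx.2 hy.2 hz hxy hx.1 hy.1⟩
      have hle := h.card_longLines_le (S \ L) {L} fun M hM => by
        by_contra! hcon
        rw [mem_longLines] at hM
        rw [mem_singleton] at hcon
        have h1 := h.card_le_card_sdiff hM.1 hL.1 hcon.1 Subset.rfl
        obtain ⟨x, hx⟩ := card_pos.1 (show 0 < #(M \ L) by omega)
        rw [mem_sdiff] at hx
        exact hcon.2 x (mem_sdiff.2 ⟨h.line_subset hM.1 hx.1, hx.2⟩) hx.1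
      have h3 := Nat.mul_le_mul_right #S hQ
      rw [card_singleton] at hle
      omega
  · push Not at hbig
    refine h.card_longLines_le_of_card_le ?_
    by_contra! hS
    exact hC (h.hasConfig_U36_of_card_line_le hS fun hx hy hxy =>
      card_line_le (by norm_num) (fun L hL => Nat.le_of_lt_succ (hbig L hL)) (isLine hx hy hxy))

end LinearSpace

end LinearSpaces

/-! ### Contractions, their simplifications, and minors. -/

/-- If the points `f i` form a copy of `N` in the contraction of the independent set `T`, then
`M` has an `N`-minor. -/
theorem hasMinor_of_contract {m : ℕ} {M : Matroid ℕ} {N : Matroid (Fin m)} (hNE : N.E = Set.univ)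
    {T : Finset ℕ} (hT : M.Indep T) {f : Fin m → ℕ} (hf : Function.Injective f)
    (hfE : ∀ i, f i ∈ M.E) (hfT : ∀ i, f i ∉ T)
    (hN : ∀ I : Finset (Fin m), N.Indep I ↔ M.Indep (I.image f ∪ T : Finset ℕ)) :
    HasMinor M N := by
  classical
  refine ⟨(M.contract T).delete (Set.range f)ᶜ, ⟨T, _, rfl⟩, ?_⟩
  have hE : ((M.contract T).delete (Set.range f)ᶜ).E = Set.range f := by
    ext x
    simp only [Matroid.delete_ground, Matroid.contract_ground, Set.mem_sdiff, Set.mem_compl_iff,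
      not_not]
    constructor
    · exact fun h => h.2
    · rintro ⟨i, rfl⟩
      exact ⟨⟨hfE i, by simpa using hfT i⟩, i, rfl⟩
  let e : Fin m ≃ ((M.contract T).delete (Set.range f)ᶜ).E :=
    (Equiv.ofInjective f hf).trans (Equiv.setCongr hE.symm)
  let e' : Fin m ≃ N.E := (Equiv.Set.univ (Fin m)).symm.trans (Equiv.setCongr hNE.symm)
  have he' : ∀ i, (e' i : Fin m) = i := fun i => rfl
  refine ⟨e.symm.trans e', fun I => ?_⟩
  obtain ⟨J, rfl⟩ : ∃ J : Finset (Fin m), I = e '' J :=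
    ⟨(e ⁻¹' I).toFinite.toFinset, by
      rw [Set.Finite.coe_toFinset, Set.image_preimage_eq _ e.surjective]⟩
  have h1 : (fun x : ((M.contract T).delete (Set.range f)ᶜ).E => (x : ℕ)) '' (e '' J) =
      (J.image f : Finset ℕ) := by
    rw [Set.image_image, coe_image]; rfl
  have h2 : (fun x => ((e.symm.trans e') x : Fin m)) '' (e '' J) = (J : Set (Fin m)) := by
    rw [Set.image_image]
    have : ∀ i, ((e.symm.trans e') (e i) : Fin m) = i := fun i => by
      rw [Equiv.trans_apply, e.symm_apply_apply, he']
    simp_rw [this, Set.image_id']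
  rw [h1, h2, hN, Matroid.delete_indep_iff, hT.contract_indep_iff, coe_union]
  constructor
  · exact fun h => h.1.2
  · intro h
    refine ⟨⟨?_, h⟩, ?_⟩
    · rw [coe_image, Set.disjoint_left]
      rintro _ ⟨i, -, rfl⟩
      exact hfT i
    · rw [coe_image, Set.disjoint_compl_right_iff_subset]
      exact Set.image_subset_range f _

theorem closure_eq_closure_of_card_le {M : Matroid ℕ} {I J : Finset ℕ} (hI : M.Indep I)
    (hcard : #J ≤ #I) (hIJ : (I : Set ℕ) ⊆ M.closure J) : M.closure I = M.closure J := by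
  have h := (M.isRkFinite_of_finite I.finite_toSet).closure_eq_closure_of_subset_of_eRk_ge_eRk hIJ
    (by
      rw [M.eRk_closure_eq, hI.eRk_eq_encard]
      refine (M.eRk_le_encard _).trans ?_
      simpa using hcard)
  rwa [M.closure_closure] at h

theorem not_isBase_of_subset_closure {M : Matroid ℕ} {I J : Finset ℕ} (hJ : #J < #I)
    (hIJ : (I : Set ℕ) ⊆ M.closure J) : ¬ M.Indep I := by
  intro hI
  have h := (hI.encard_le_eRk_of_subset hIJ).trans_eq (M.eRk_closure_eq J)
  have h2 := h.trans (M.eRk_le_encard _)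
  simp only [Set.encard_coe_eq_coe_finsetCard, Nat.cast_le] at h2
  omega

theorem mem_closure_of_not_indep_insert {M : Matroid ℕ} {I : Set ℕ} (hI : M.Indep I) {x : ℕ}
    (hx : x ∈ M.E) (h : ¬ M.Indep (insert x I)) : x ∈ M.closure I := by
  have hxI : x ∉ I := fun hxI => h (by rwa [Set.insert_eq_of_mem hxI])
  rw [hI.mem_closure_iff_of_notMem hxI]
  exact ⟨h, Set.insert_subset hx hI.subset_ground⟩

theorem notMem_closure_of_indep_insert {M : Matroid ℕ} {I : Set ℕ} {x : ℕ} (hxI : x ∉ I)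
    (h : M.Indep (insert x I)) : x ∉ M.closure I := by
  have hI := h.subset (Set.subset_insert x I)
  exact ((hI.insert_indep_iff_of_notMem hxI).1 h).2

/-- `S` is a set of points of the contraction of `T` in `M`, no two of which are parallel. -/
structure IsSimpleOver (M : Matroid ℕ) (T S : Finset ℕ) : Prop where
  notMem : ∀ x ∈ S, x ∉ T
  indep_one : ∀ x ∈ S, M.Indep (insert x (T : Set ℕ))
  indep_two : ∀ x ∈ S, ∀ y ∈ S, x ≠ y → M.Indep (insert x (insert y (T : Set ℕ)))

/-- Take `S` maximal: a point parallel to no member of `S` could be added. -/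
theorem exists_simplification {M : Matroid ℕ} {n : ℕ} (hE : M.E = Set.Icc 1 n) (T : Finset ℕ) :
    ∃ S ⊆ Icc 1 n, IsSimpleOver M T S ∧ ∀ a, a ∉ T → M.Indep (insert a (T : Set ℕ)) →
      ∃ s ∈ S, M.closure (insert a (T : Set ℕ)) = M.closure (insert s (T : Set ℕ)) := by
  classical
  obtain ⟨S, -, hS⟩ := exists_le_maximal {S ∈ (Icc 1 n).powerset | IsSimpleOver M T S}
    (a := ∅) (mem_filter.2 ⟨by simp, by simp, by simp, by simp⟩)
  obtain ⟨hSmem, hSs⟩ := mem_filter.1 hS.prop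
  rw [mem_powerset] at hSmem
  refine ⟨S, hSmem, hSs, fun a haT ha => ?_⟩
  by_cases haS : a ∈ S
  · exact ⟨a, haS, rfl⟩
  have haE : a ∈ M.E := ha.subset_ground (Set.mem_insert _ _)
  have hdep : ∃ s ∈ S, ¬ M.Indep (insert a (insert s (T : Set ℕ))) := by
    by_contra! hcon
    refine haS (hS.le_of_ge (y := insert a S) (mem_filter.2 ⟨?_, ?_, ?_, ?_⟩) (subset_insert _ _)
      (mem_insert_self _ _))
    · rw [hE, ← coe_Icc] at haE
      exact mem_powerset.2 (insert_subset haE hSmem)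
    · simpa using ⟨haT, hSs.notMem⟩
    · simpa using ⟨ha, hSs.indep_one⟩
    · intro x hx y hy hxy
      rw [mem_insert] at hx hy
      rcases hx with rfl | hx <;> rcases hy with rfl | hy
      · exact absurd rfl hxy
      · exact hcon y hy
      · rw [Set.insert_comm]; exact hcon x hx
      · exact hSs.indep_two x hx y hy hxy
  obtain ⟨s, hs, hsdep⟩ := hdep
  have hsi := hSs.indep_one s hs
  refine ⟨s, hs, ?_⟩
  have hmem := mem_closure_of_not_indep_insert hsi haE hsdep
  rw [← coe_insert, ← coe_insert]
  refine closure_eq_closure_of_card_le (by rwa [coe_insert]) ?_ ?_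
  · rw [card_insert_of_notMem haT, card_insert_of_notMem (hSs.notMem s hs)]
  · rw [coe_insert, coe_insert]
    exact Set.insert_subset hmem ((Set.subset_insert _ _).trans (M.subset_closure _ hsi.subset_ground))

theorem card_le_of_indep_image_union {m s : ℕ} {M : Matroid ℕ} {T : Finset ℕ}
    (hr : ∃ B : Finset ℕ, M.IsBase B ∧ #B = #T + s) {f : Fin m → ℕ} (hf : Function.Injective f)
    (hfT : ∀ i, f i ∉ T) {I : Finset (Fin m)} (hI : M.Indep (I.image f ∪ T : Finset ℕ)) :
    #I ≤ s := by
  obtain ⟨B, hB, hBc⟩ := hr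
  have h1 := hI.encard_le_eRank
  rw [← hB.encard_eq_eRank] at h1
  simp only [Set.encard_coe_eq_coe_finsetCard, Nat.cast_le] at h1
  rw [card_union_of_disjoint, card_image_of_injective _ hf, hBc] at h1
  · omega
  · rw [disjoint_left]
    intro x hx
    obtain ⟨i, -, rfl⟩ := mem_image.1 hx
    exact hfT i

theorem IsSimpleOver.indep_image_union {m : ℕ} {M : Matroid ℕ} {T S : Finset ℕ} (hT : M.Indep T)
    (hS : IsSimpleOver M T S) {f : Fin m → ℕ} (hf : Function.Injective f) (hfS : ∀ i, f i ∈ S)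
    {I : Finset (Fin m)} (hI : #I ≤ 2) : M.Indep (I.image f ∪ T : Finset ℕ) := by
  obtain h | h | h : #I = 0 ∨ #I = 1 ∨ #I = 2 := by omega
  · rw [card_eq_zero] at h; subst h; simpa using hT
  · obtain ⟨i, rfl⟩ := card_eq_one.1 h
    simpa using hS.indep_one _ (hfS i)
  · obtain ⟨i, j, hij, rfl⟩ := card_eq_two.1 h
    have := hS.indep_two _ (hfS i) _ (hfS j) (hf.ne hij)
    simpa [insert_union] using this

theorem exists_finset_isBase {M : Matroid ℕ} {n : ℕ} (hE : M.E = Set.Icc 1 n) :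
    ∃ B : Finset ℕ, M.IsBase B := by
  obtain ⟨B, hB⟩ := M.exists_isBase
  have hfin : B.Finite := (Set.finite_Icc 1 n).subset (hE ▸ hB.subset_ground)
  exact ⟨hfin.toFinset, by simpa using hB⟩

/-! ### Sparsity in ranks two and three. -/

/-- Any `k` pairwise non-parallel points of a rank-two contraction form `U_{2,k}`. The hyperplanes
are the parallel classes together with the closure of `T`. -/
theorem flatSparse_unif_two (k : ℕ) : FlatSparse (unif 2 k) 2 k := by
  classical
  intro n hn M hM T hT hr
  have hE : M.E = Set.Icc 1 n := hM.1
  obtain ⟨B, hB⟩ := exists_finset_isBase hE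
  obtain ⟨S, hSn, hS, hpar⟩ := exists_simplification hE T
  have hSk : #S ≤ k := by
    by_contra! hk
    have hf : Function.Injective (fun i : Fin k => S.orderEmbOfFin rfl (Fin.castLE hk.le i)) :=
      (S.orderEmbOfFin rfl).injective.comp (Fin.castLE_injective hk.le)
    have hfS : ∀ i : Fin k, S.orderEmbOfFin rfl (Fin.castLE hk.le i) ∈ S :=
      fun i => orderEmbOfFin_mem _ _ _
    refine hM.2 (hasMinor_of_contract rfl hT hf (fun i => ?_) (fun i => hS.notMem _ (hfS i))
      fun I => ?_)
    · exact (hS.indep_one _ (hfS i)).subset_ground (Set.mem_insert _ _)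
    · rw [unif_indep_iff]
      exact ⟨hS.indep_image_union hT hf hfS,
        card_le_of_indep_image_union ⟨B, hB, hr B hB⟩ hf fun i => hS.notMem _ (hfS i)⟩
  refine ⟨S.image fun s => {x ∈ Icc 1 n | x ∈ M.closure (insert s (T : Set ℕ))}, ?_, ?_, ?_, ?_⟩
  · intro K hK
    obtain ⟨s, -, rfl⟩ := mem_image.1 hK
    exact mem_powerset.2 (filter_subset _ _)
  · simpa using card_image_le.trans hSk
  · intro K hK I hIK hI
    obtain ⟨s, hs, rfl⟩ := mem_image.1 hK
    refine not_isBase_of_subset_closure (J := insert s T) ?_ ?_ hI.indep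
    · rw [hr I hI, card_insert_of_notMem (hS.notMem s hs)]; omega
    · intro x hx
      rw [coe_insert]
      exact (mem_filter.1 (hIK hx)).2
  · intro Y hYE hY hTY hind hdep
    obtain ⟨a, b, hab, rfl⟩ := card_eq_two.1 hY
    have haT : a ∉ T := fun h => disjoint_left.1 hTY h (by simp)
    have hbT : b ∉ T := fun h => disjoint_left.1 hTY h (by simp)
    have ha : M.Indep (insert a (T : Set ℕ)) := by
      have h := hind b (by simp)
      rwa [show ({a, b} : Finset ℕ).erase b = {a} by ext x; simp; grind, union_comm, ← insert_eq,
        coe_insert] at h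
    have hb : b ∈ M.closure (insert a (T : Set ℕ)) := by
      refine mem_closure_of_not_indep_insert ha (hYE (by simp)) fun h => hdep ?_
      have : ((T ∪ {a, b} : Finset ℕ) : Set ℕ) = insert b (insert a (T : Set ℕ)) := by
        ext x; simp; tauto
      rwa [this]
    obtain ⟨s, hs, hcl⟩ := hpar a haT ha
    refine ⟨_, mem_image_of_mem _ hs, fun x hx => mem_filter.2 ⟨?_, ?_⟩⟩
    · rw [← mem_coe, coe_Icc, ← hE]
      rw [mem_union] at hx
      rcases hx with hx | hx
      · exact hT.subset_ground hx
      · exact hYE hx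
    · rw [← hcl]
      have hsub := M.subset_closure _ ha.subset_ground
      simp only [mem_union, mem_insert, mem_singleton] at hx
      rcases hx with hx | rfl | rfl
      · exact hsub (Set.mem_insert_of_mem _ hx)
      · exact hsub (Set.mem_insert _ _)
      · exact hb

open Classical in
/-- The line through `x` and `y` in the simplification `S` of the contraction of `T`. -/
noncomputable def contractLine (M : Matroid ℕ) (T S : Finset ℕ) (x y : ℕ) : Finset ℕ :=
  {z ∈ S | z ∈ M.closure (insert x (insert y (T : Set ℕ)))}

theorem mem_contractLine {M : Matroid ℕ} {T S : Finset ℕ} {x y z : ℕ} :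
    z ∈ contractLine M T S x y ↔ z ∈ S ∧ z ∈ M.closure (insert x (insert y (T : Set ℕ))) := by
  simp [contractLine]

theorem IsSimpleOver.closure_eq {M : Matroid ℕ} {T : Finset ℕ} {u v x y : ℕ} (hu : u ∉ T)
    (hv : v ∉ T) (huv : u ≠ v) (hind : M.Indep (insert u (insert v (T : Set ℕ))))
    (h : insert u (insert v (T : Set ℕ)) ⊆ M.closure (insert x (insert y (T : Set ℕ)))) :
    M.closure (insert u (insert v (T : Set ℕ))) = M.closure (insert x (insert y (T : Set ℕ))) := by
  simp only [← coe_insert] at *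
  refine closure_eq_closure_of_card_le hind ?_ h
  rw [card_insert_of_notMem (s := insert v T) (by simp [*]), card_insert_of_notMem hv]
  exact (card_insert_le _ _).trans (Nat.add_le_add_right (card_insert_le _ _) _)

theorem IsSimpleOver.linearSpace {M : Matroid ℕ} {T S : Finset ℕ} (hS : IsSimpleOver M T S) :
    LinearSpace S (contractLine M T S) where
  subset _ _ _ _ hz := (mem_contractLine.1 hz).1
  left hx hy hxy := mem_contractLine.2
    ⟨hx, M.subset_closure _ (hS.indep_two _ hx _ hy hxy).subset_ground (by simp)⟩
  right hx hy hxy := mem_contractLine.2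
    ⟨hy, M.subset_closure _ (hS.indep_two _ hx _ hy hxy).subset_ground (by simp)⟩
  eq {x y u v} hx hy hxy hu hv huv := by
    rw [mem_contractLine] at hu hv
    have hsub := M.subset_closure _ (hS.indep_two _ hx _ hy hxy).subset_ground
    have hcl := IsSimpleOver.closure_eq (hS.notMem u hu.1) (hS.notMem v hv.1) huv
      (hS.indep_two u hu.1 v hv.1 huv) (Set.insert_subset hu.2 (Set.insert_subset hv.2
        fun z hz => hsub (by simp [mem_coe.1 hz])))
    ext z
    rw [mem_contractLine, mem_contractLine, hcl]

theorem exists_sorted_triple {m : ℕ} {I : Finset (Fin m)} (hI : #I = 3) :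
    ∃ i j k, i < j ∧ j < k ∧ I = {i, j, k} := by
  refine ⟨I.orderEmbOfFin hI 0, I.orderEmbOfFin hI 1, I.orderEmbOfFin hI 2, by simp, by simp, ?_⟩
  conv_lhs => rw [← image_orderEmbOfFin_univ I hI]
  have : (univ : Finset (Fin 3)) = {0, 1, 2} := by decide
  rw [this]
  simp

/-- The six points of a configuration represent the corresponding matroid. -/
theorem hasMinor_of_hasConfig {M : Matroid ℕ} {T S B : Finset ℕ} (hT : M.Indep T)
    (hB : M.IsBase B) (hr : #B = #T + 3) (hS : IsSimpleOver M T S)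
    {C : Finset (Finset (Fin 6))} (hC3 : ∀ X ∈ C, #X = 3) {N : Matroid (Fin 6)}
    (hNE : N.E = Set.univ) (hN : ∀ I : Finset (Fin 6), N.Indep I ↔ #I ≤ 3 ∧ I ∉ C)
    (h : HasConfig S (contractLine M T S) C) : HasMinor M N := by
  obtain ⟨f, hf, hfS, hcol⟩ := h
  have hfT := fun i => hS.notMem _ (hfS i)
  have hfE : ∀ i, f i ∈ M.E := fun i =>
    (hS.indep_one _ (hfS i)).subset_ground (Set.mem_insert _ _)
  refine hasMinor_of_contract hNE hT hf hfE hfT fun I => ?_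
  rw [hN]
  -- Only triples matter: smaller sets are independent by simplicity, larger ones are dependent by
  -- rank.
  have hthree : #I = 3 → (M.Indep (I.image f ∪ T : Finset ℕ) ↔ I ∉ C) := by
    intro hI
    obtain ⟨i, j, k, hij, hjk, rfl⟩ := exists_sorted_triple hI
    rw [← hcol i j k hij hjk, mem_contractLine, and_iff_right (hfS k)]
    have hcoe : ((({i, j, k} : Finset (Fin 6)).image f ∪ T : Finset ℕ) : Set ℕ) =
        insert (f k) (insert (f i) (insert (f j) (T : Set ℕ))) := by
      ext x; simp; tauto
    rw [hcoe, (hS.indep_two _ (hfS i) _ (hfS j) (hf.ne hij.ne)).insert_indep_iff_of_notMem]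
    · simp [hfE k]
    · have h1 := hfT k
      have h2 := hf.ne (hij.trans hjk).ne'
      have h3 := hf.ne hjk.ne'
      simp [h1, h2, h3]
  constructor
  · rintro ⟨hI, hIC⟩
    rcases hI.lt_or_eq with hI | hI
    · exact hS.indep_image_union hT hf hfS (by omega)
    · exact (hthree hI).2 hIC
  · intro hI
    have hI3 := card_le_of_indep_image_union ⟨B, hB, hr⟩ hf hfT hI
    exact ⟨hI3, fun hIC => (hthree (hC3 I hIC)).1 hI hIC⟩

/-- The recorded hyperplanes are the spans of `T` with a long line. A three-element circuit of the
contraction, moved to parallel representatives in `S`, becomes three distinct collinear points, so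
its line is long. -/
theorem flatSparse_three {C : Finset (Finset (Fin 6))} (hC3 : ∀ X ∈ C, #X = 3)
    {N : Matroid (Fin 6)} (hNE : N.E = Set.univ)
    (hN : ∀ I : Finset (Fin 6), N.Indep I ↔ #I ≤ 3 ∧ I ∉ C)
    (hlong : ∀ (S : Finset ℕ) (ln : ℕ → ℕ → Finset ℕ), LinearSpace S ln → ¬ HasConfig S ln C →
      #(longLines S ln) ≤ 100 * #S) : FlatSparse N 3 100 := by
  classical
  intro n hn M hM T hT hr
  have hE : M.E = Set.Icc 1 n := hM.1
  obtain ⟨B, hB⟩ := exists_finset_isBase hE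
  obtain ⟨S, hSn, hS, hpar⟩ := exists_simplification hE T
  have hle := hlong S _ hS.linearSpace
    fun h => hM.2 (hasMinor_of_hasConfig hT hB (hr B hB) hS hC3 hNE hN h)
  have hSn' : #S ≤ n := by simpa using card_le_card hSn
  refine ⟨(longLines S (contractLine M T S)).image fun L =>
    {x ∈ Icc 1 n | x ∈ M.closure (T ∪ L : Finset ℕ)}, ?_, ?_, ?_, ?_⟩
  · intro K hK
    obtain ⟨L, -, rfl⟩ := mem_image.1 hK
    exact mem_powerset.2 (filter_subset _ _)
  · refine card_image_le.trans (hle.trans ?_)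
    simpa using hSn'
  · intro K hK I hIK hI
    obtain ⟨L, hL, rfl⟩ := mem_image.1 hK
    obtain ⟨⟨x, hx, y, hy, hxy, rfl⟩, -⟩ := LinearSpace.mem_longLines.1 hL
    refine not_isBase_of_subset_closure (J := insert x (insert y T)) ?_ ?_ hI.indep
    · have h1 := card_insert_le x (insert y T)
      have h2 := card_insert_le y T
      rw [hr I hI]; omega
    · intro z hz
      refine M.closure_subset_closure_of_subset_closure ?_ (mem_filter.1 (hIK hz)).2
      rw [coe_union, coe_insert, coe_insert]
      refine Set.union_subset (fun w hw => ?_) fun w hw => (mem_contractLine.1 hw).2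
      exact M.subset_closure _ (hS.indep_two x hx y hy hxy).subset_ground (by simp [mem_coe.1 hw])
  · intro Y hYE hY hTY hind hdep
    obtain ⟨a, b, c, hab, hac, hbc, rfl⟩ := card_eq_three.1 hY
    have haT : a ∉ T := fun h => disjoint_left.1 hTY h (by simp)
    have hbT : b ∉ T := fun h => disjoint_left.1 hTY h (by simp)
    have hcT : c ∉ T := fun h => disjoint_left.1 hTY h (by simp)
    have hpair : ∀ {u v w}, u ≠ w → v ≠ w → ({a, b, c} : Finset ℕ) = {u, v, w} →
        M.Indep (insert u (insert v (T : Set ℕ))) := by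
      intro u v w huw hvw heq
      have h := hind w (by simp [heq])
      have h2 : ((T ∪ ({a, b, c} : Finset ℕ).erase w : Finset ℕ) : Set ℕ) =
          insert u (insert v (T : Set ℕ)) := by
        rw [heq]; ext x; simp; grind
      rwa [h2] at h
    have iab := hpair hac hbc rfl
    have iac := hpair hab hbc.symm (by ext x; simp; tauto)
    have ibc := hpair hab.symm hac.symm (by ext x; simp; tauto)
    have ia := iab.subset (Set.insert_subset_insert (Set.subset_insert b _))
    have ib := ibc.subset (Set.insert_subset_insert (Set.subset_insert c _))
    have ic := ibc.subset (Set.subset_insert b _)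
    have hsub : ∀ {u}, M.Indep (insert u (T : Set ℕ)) → u ∈ M.closure (insert u (T : Set ℕ)) :=
      fun hu => M.subset_closure _ hu.subset_ground (Set.mem_insert _ _)
    -- A common representative would make `u` and `v` parallel over `T`.
    have hne : ∀ {u v u' v'}, u ≠ v → u ∉ T → M.Indep (insert u (insert v (T : Set ℕ))) →
        M.closure (insert u (T : Set ℕ)) = M.closure (insert u' (T : Set ℕ)) →
        M.closure (insert v (T : Set ℕ)) = M.closure (insert v' (T : Set ℕ)) → u' ≠ v' := by
      rintro u v u' v' huv huT hi hu hv rfl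
      refine notMem_closure_of_indep_insert (by simp [huv, huT]) hi ?_
      rw [hv, ← hu]
      exact hsub (hi.subset (Set.insert_subset_insert (Set.subset_insert v _)))
    obtain ⟨a', ha', hcla⟩ := hpar a haT ia
    obtain ⟨b', hb', hclb⟩ := hpar b hbT ib
    obtain ⟨c', hc', hclc⟩ := hpar c hcT ic
    have hab' := hne hab haT iab hcla hclb
    have hac' := hne hac haT iac hcla hclc
    have hbc' := hne hbc hbT ibc hclb hclc
    have i' := hS.indep_two a' ha' b' hb' hab'
    have hsub' := M.subset_closure _ i'.subset_ground
    have ha : a ∈ M.closure (insert a' (insert b' (T : Set ℕ))) :=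
      M.closure_subset_closure (Set.insert_subset_insert (Set.subset_insert b' _)) (hcla ▸ hsub ia)
    have hb : b ∈ M.closure (insert a' (insert b' (T : Set ℕ))) :=
      M.closure_subset_closure (Set.subset_insert a' _) (hclb ▸ hsub ib)
    have hT' : (T : Set ℕ) ⊆ M.closure (insert a' (insert b' (T : Set ℕ))) :=
      fun z hz => hsub' (by simp [mem_coe.1 hz])
    have hcl := IsSimpleOver.closure_eq haT hbT hab iab
      (Set.insert_subset ha (Set.insert_subset hb hT'))
    have hc : c ∈ M.closure (insert a' (insert b' (T : Set ℕ))) := by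
      rw [← hcl]
      refine mem_closure_of_not_indep_insert iab (hYE (by simp)) fun h => hdep ?_
      have : ((T ∪ {a, b, c} : Finset ℕ) : Set ℕ) = insert c (insert a (insert b (T : Set ℕ))) := by
        ext x; simp; tauto
      rwa [this]
    have hcmem : c' ∈ M.closure (insert a' (insert b' (T : Set ℕ))) :=
      M.closure_subset_closure_of_subset_closure (Set.insert_subset hc hT')
        (hclc ▸ hsub (hS.indep_one c' hc'))
    have hL := hS.linearSpace
    have hlongL : contractLine M T S a' b' ∈ longLines S (contractLine M T S) :=
      LinearSpace.mem_longLines.2 ⟨⟨a', ha', b', hb', hab', rfl⟩, two_lt_card.2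
        ⟨a', hL.left ha' hb' hab', b', hL.right ha' hb' hab', c',
          mem_contractLine.2 ⟨hc', hcmem⟩, hab', hac', hbc'⟩⟩
    refine ⟨_, mem_image_of_mem _ hlongL, fun x hx => mem_filter.2 ⟨?_, ?_⟩⟩
    · rw [← mem_coe, coe_Icc, ← hE]
      rw [mem_union] at hx
      rcases hx with hx | hx
      · exact hT.subset_ground hx
      · exact hYE hx
    · refine M.closure_subset_closure (X := insert a' (insert b' (T : Set ℕ))) ?_ ?_
      · rw [coe_union]
        exact Set.insert_subset (Or.inr (hL.left ha' hb' hab'))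
          (Set.insert_subset (Or.inr (hL.right ha' hb' hab')) Set.subset_union_left)
      · simp only [mem_union, mem_insert, mem_singleton] at hx
        rcases hx with hx | rfl | rfl | rfl
        · exact hT' hx
        · exact ha
        · exact hb
        · exact hc

end MatroidCount

theorem theorem4p1 :
    (∀ k : ℕ, 2 ≤ k → MatroidCount.SmallExcluded (MatroidCount.unif 2 k)) ∧
      MatroidCount.SmallExcluded (MatroidCount.unif 3 6) ∧
      MatroidCount.SmallExcluded MatroidCount.P6 ∧
      MatroidCount.SmallExcluded MatroidCount.Q6 ∧
      MatroidCount.SmallExcluded MatroidCount.R6 := by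
  refine ⟨fun k _ => (MatroidCount.flatSparse_unif_two k).smallExcluded le_rfl, ?_, ?_, ?_, ?_⟩
  · refine (MatroidCount.flatSparse_three (C := ∅) (by simp) rfl (fun I => ?_) fun S ln h hC =>
      h.card_longLines_le_of_not_hasConfig_U36 hC).smallExcluded (by norm_num)
    simp [MatroidCount.unif_indep_iff]
  · exact (MatroidCount.flatSparse_three (by decide) rfl
      (MatroidCount.ofNonbases_indep_iff 3 6 _ _ _ _) fun S ln h hC =>
      h.card_longLines_le_of_not_hasConfig_P6 hC).smallExcluded (by norm_num)
  · exact (MatroidCount.flatSparse_three (by decide) rfl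
      (MatroidCount.ofNonbases_indep_iff 3 6 _ _ _ _) fun S ln h hC =>
      h.card_longLines_le_of_not_hasConfig_Q6 hC).smallExcluded (by norm_num)
  · exact (MatroidCount.flatSparse_three (by decide) rfl
      (MatroidCount.ofNonbases_indep_iff 3 6 _ _ _ _) fun S ln h hC =>
      h.card_longLines_le_of_not_hasConfig_R6 hC).smallExcluded (by norm_num)
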